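/- For $\alpha\ge 1$ let $\mu_\alpha$ be the probability measure $\mu_\alpha(dx)=\frac1{Z_\alpha}e^{-|x|^\alpha}dx$ on $\mathbb R$, where $Z_\alpha=\int_{\mathbb R} e^{-|x|^\alpha}dx$. For $f\in L^2(\mu_\alpha)$ write $$\mathrm{Ent}_{\mu_\alpha}(f^2)=\int f^2\log\frac{f^2}{\int f^2d\mu_\alpha}\,d\mu_\alpha\in[0,\infty],\qquad \mathrm{Var}_{\mu_\alpha}(f)=\int f^2d\mu_\alpha-\Big(\int f\,d\mu_\alpha\Big)^2 .$$ 1. Let $\alpha\in\,]1,2]$ and let $\beta$ be defined by $1/\alpha+1/\beta=1$. There are constants $A,B>0$ (depending only on $\alpha$) such that for every $C^\infty$ function $f:\mathbb R\to[0,\infty)$ with $\int f^2d\mu_\alpha=1$, $$\mathrm{Ent}_{\mu_\alpha}(f^2)\le A\,\mathrm{Var}_{\mu_\alpha}(f)+B\int_{\{f\ge 2\}}\Big|\frac{f'}{f}\Big|^\beta f^2\,d\mu_\alpha ,$$ where the right-hand side may be $+\infty$. 2. In the extreme case $\alpha=1$ there is a constant $A>0$ such that for every $C^1$ function $f:\mathbb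 R\to[0,\infty)$ with $\int f^2d\mu_1=1$ and $|f'|\le 1$, $$\mathrm{Ent}_{\mu_1}(f^2)\le A\,\mathrm{Var}_{\mu_1}(f).$$ 3. For every $\alpha\in[1,2]$ there are $a>0$ and $0<C<\infty$ such that $\mu_\alpha$ satisfies the modified logarithmic Sobolev inequality $LSI_{a,\alpha}(C)$: for every $C^\infty$ function $f:\mathbb R\to\mathbb R$ with $f\in L^2(\mu_\alpha)$, $$\mathrm{Ent}_{\mu_\alpha}(f^2)\le C\int H_{a,\alpha}\Big(\frac{f'}{f}\Big)f^2\,d\mu_\alpha ,$$ where the integrand is taken to be $0$ at the zeros of $f$, where $H_{a,\alpha}(x)=\frac{x^2}{2}$ if $|x|\le a$ and, for $|x|>a$, $$H_{a,\alpha}(x)=a^{2-\beta}\frac{|x|^\beta}{\beta}+a^2\,\frac{\beta-2}{2\beta}\quad\text{if }\alpha\in\,]1,2],\ \tfrac1\alpha+\tfrac1\beta=1,\qquad H_{a,1}(x)=+\infty\quad\text{if }\alpha=1 .$$ -/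

import Mathlib

open MeasureTheory ProbabilityTheory
open scoped ENNReal ContDiff

namespace ModLSI

/-- The normalising constant `Z_α = ∫ exp (-|x|^α) dx`. -/
noncomputable def partitionZ (α : ℝ) : ℝ := ∫ x : ℝ, Real.exp (-|x| ^ α)

/-- The measure `μ_α (dx) = Z_α⁻¹ exp (-|x|^α) dx` on the real line. -/
noncomputable def muAlpha (α : ℝ) : Measure ℝ :=
  volume.withDensity fun x => ENNReal.ofReal (Real.exp (-|x| ^ α) / partitionZ α)

open Classical in
/-- The entropy `Ent_μ(g) = ∫ g log (g / ∫ g dμ) dμ` of a nonnegative `μ`-integrable function `g`,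
as an element of `[0, ∞]`. For such `g` and a probability measure `μ` the negative part of
`g log (g / ∫ g dμ)` is integrable and the integral is nonnegative, so that the integral is `+∞`
exactly when the integrand is not integrable. -/
noncomputable def entropy (μ : Measure ℝ) (g : ℝ → ℝ) : ℝ≥0∞ :=
  if Integrable (fun x => g x * Real.log (g x / ∫ y, g y ∂μ)) μ then
    ENNReal.ofReal (∫ x, g x * Real.log (g x / ∫ y, g y ∂μ) ∂μ)
  else ⊤

/-- The function `H_{a,α}` with values in `[0, ∞]`. Here `β = Real.conjExponent α = α / (α - 1)` is
the conjugate exponent; for `α = 1` the function is infinite outside `[-a, a]`. -/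
noncomputable def modH (a α x : ℝ) : ℝ≥0∞ :=
  if |x| ≤ a then ENNReal.ofReal (x ^ 2 / 2)
  else if α = 1 then ⊤
  else ENNReal.ofReal
    (a ^ (2 - α.conjExponent) * (|x| ^ α.conjExponent / α.conjExponent)
      + a ^ 2 * ((α.conjExponent - 2) / (2 * α.conjExponent)))

/-- The inequality `LSI_{a,α}(C)` for a measure on the real line:
`Ent_μ(f²) ≤ C ∫ H_{a,α}(f'/f) f² dμ` for all smooth square-integrable `f`. At a zero of `f` the
integrand is `0`, by the convention `∞ * 0 = 0`. -/
def SatisfiesLSI (μ : Measure ℝ) (a α C : ℝ) : Prop :=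
  ∀ f : ℝ → ℝ, ContDiff ℝ ∞ f → MemLp f 2 μ →
    entropy μ (fun x => f x ^ 2) ≤
      ENNReal.ofReal C * ∫⁻ x, modH a α (deriv f x / f x) * ENNReal.ofReal (f x ^ 2) ∂μ

end ModLSI

/-!
All three parts rest on one-dimensional integration by parts against `exp (-x^α)`, done separately
on the two half-lines, together with a `C¹` truncation of `f²`.

Write `θ(s) = s log s - s + 1 ≥ 0`. For `∫ f² dμ = 1` the entropy of `f²` is `∫ θ(f²) dμ`
(`entropy_sq_le_lintegral`), and `θ(t²) ≤ (|t| - 1)² (2 |t| + 1)`. Since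
`∫ (|f| - 1)² dμ = 2 - 2 ∫ |f| dμ ≤ 2 Var f`, the region `|f| ≤ 4` is controlled by the variance, and
only large values of `f` matter.

For a `C¹` function `W ≥ 0`, integrating the derivative of `W exp (-x^α)` shows that a pointwise
inequality `P + W' ≤ α x^(α-1) W + Q` implies `∫ P ≤ W(0) + ∫ Q`
(`lintegral_halfMeasure_le_of_lyapunov`). Nothing needs to be integrable beforehand, because
absorption takes place pointwise and the boundary term at infinity has the good sign.

* With `W = 6 (1 + exp (-x)) (f - f(0))²` this is the Poincaré inequality.
* For `1 < α ≤ 2` let `w = bump n ∘ f` be a truncation of `f²` to `|f| ≥ 2`, vanishing to high order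
  at `|f| = 2`, so that Young's inequality gives
  `x |w'| ≤ ½ x^α w + C |f'/f|^β f² 1_{|f| ≥ 2}`. The choice `W = x w` bounds `∫ x^α w`, and a Sobolev
  bound (`ofReal_mul_exp_le_lintegral`) then controls `sup w exp (-x^α)`. For `|f| ≥ 4` the estimate
  `log (f²) = log (f² exp (-x^α)) + x^α ≤ f² exp (-x^α) + x^α` turns both into a bound on the entropy
  (`lintegral_entropyFun_halfMeasure_le`). Since `∫ f² dμ = 1`, that bound is linear in the variance
  and the gradient term.
* For `α = 1` and `|f'| ≤ 1 + |f| / 12`, the choice `W = 4 (f² - 4)₊²` bounds a fourth power of `f`,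
  which dominates `θ(f²)`. The growth condition holds both when `|f'| ≤ 1` and when
  `|f'| ≤ |f| / 12`.

The modified logarithmic Sobolev inequality follows by combining these with the Poincaré inequality,
since `x²` and `|x|^β` are at most `β H_{1,α}(x)`. For `α = 1` the right-hand side with `a = 1/12` is
finite only if `|f'| ≤ |f| / 12` everywhere.
-/

namespace ModLSI

open Set Filter Topology

/-! ### Differential inequalities on the half-line -/

/-- The measure `exp (-x^α) dx` on the half-line `(0, ∞)`. Up to the factor `Z_α`, the measure
`muAlpha α` is the sum of this measure and of its reflection. -/
noncomputable def halfMeasure (α : ℝ) : Measure ℝ :=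
  (volume.restrict (Ioi 0)).withDensity fun x => ENNReal.ofReal (Real.exp (-x ^ α))

lemma continuous_exp_neg_rpow {α : ℝ} (hα : 1 ≤ α) :
    Continuous fun x : ℝ => Real.exp (-x ^ α) :=
  Real.continuous_exp.comp
    (Real.continuous_rpow_const (by linarith)).neg

lemma lintegral_halfMeasure {α : ℝ} (hα : 1 ≤ α) (F : ℝ → ℝ≥0∞) :
    ∫⁻ x, F x ∂(halfMeasure α)
      = ∫⁻ x in Ioi 0, ENNReal.ofReal (Real.exp (-x ^ α)) * F x := by
  unfold halfMeasure
  rw [lintegral_withDensity_eq_lintegral_mul_non_measurable _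
    (continuous_exp_neg_rpow hα).measurable.ennreal_ofReal (by simp)]
  rfl

lemma lintegral_ofReal_halfMeasure {α : ℝ} (hα : 1 ≤ α) (F : ℝ → ℝ) :
    ∫⁻ x, ENNReal.ofReal (F x) ∂(halfMeasure α)
      = ∫⁻ x in Ioi 0, ENNReal.ofReal (F x * Real.exp (-x ^ α)) := by
  rw [lintegral_halfMeasure hα]
  refine lintegral_congr fun x => ?_
  rw [mul_comm (F x), ENNReal.ofReal_mul (Real.exp_pos _).le]

/-- To bound integrals against `halfMeasure α` it suffices to compare the integrands at positive
points. -/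
lemma lintegral_halfMeasure_mono {α : ℝ} (hα : 1 ≤ α) {F G : ℝ → ℝ≥0∞}
    (h : ∀ x, 0 < x → F x ≤ G x) :
    ∫⁻ x, F x ∂(halfMeasure α) ≤ ∫⁻ x, G x ∂(halfMeasure α) := by
  rw [lintegral_halfMeasure hα, lintegral_halfMeasure hα]
  refine setLIntegral_mono' measurableSet_Ioi fun x hx => ?_
  gcongr
  exact h x hx

/-- An integrated differential inequality `p + G' ≤ q`, where `q` is only assumed measurable. -/
lemma sub_add_integral_le_toReal {a b : ℝ} (hab : a ≤ b) {G G' p q : ℝ → ℝ}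
    (hG : ContinuousOn G (Icc a b)) (hG' : ∀ x ∈ Ioo a b, HasDerivAt G (G' x) x)
    (hp : ContinuousOn p (Icc a b)) (hq : Measurable q) (hq0 : ∀ x ∈ Ioc a b, 0 ≤ q x)
    (h : ∀ x ∈ Ioo a b, p x + G' x ≤ q x)
    (hfin : ∫⁻ x in Ioc a b, ENNReal.ofReal (q x) ≠ ⊤) :
    G b - G a + ∫ x in Ioc a b, p x ≤ (∫⁻ x in Ioc a b, ENNReal.ofReal (q x)).toReal := by
  have hq0' : 0 ≤ᵐ[volume.restrict (Ioc a b)] q :=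
    (ae_restrict_iff' measurableSet_Ioc).2 (.of_forall hq0)
  have hqi : IntegrableOn q (Ioc a b) :=
    (lintegral_ofReal_ne_top_iff_integrable hq.aestronglyMeasurable hq0').1 hfin
  have hpi : IntegrableOn p (Icc a b) := hp.integrableOn_Icc
  have hqi' : IntegrableOn q (Icc a b) := (integrableOn_Icc_iff_integrableOn_Ioc).2 hqi
  have key := intervalIntegral.sub_le_integral_of_hasDeriv_right_of_le hab hG
    (fun x hx => (hG' x hx).hasDerivWithinAt) (hqi'.sub hpi)
    (fun x hx => by simpa using (by linarith [h x hx] : G' x ≤ q x - p x))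
  rw [intervalIntegral.integral_of_le hab] at key
  simp only [Pi.sub_apply] at key
  rw [integral_sub hqi (hpi.mono_set Ioc_subset_Icc_self)] at key
  rw [← integral_eq_lintegral_of_nonneg_ae hq0' hq.aestronglyMeasurable]
  linarith

lemma hasDerivAt_mul_exp_neg_rpow {α : ℝ} (hα : 1 ≤ α) {W W' : ℝ → ℝ}
    (hW : ∀ x, HasDerivAt W (W' x) x) (x : ℝ) :
    HasDerivAt (fun x => W x * Real.exp (-x ^ α))
      ((W' x - α * x ^ (α - 1) * W x) * Real.exp (-x ^ α)) x := by
  have h1 : HasDerivAt (fun x : ℝ => x ^ α) (α * x ^ (α - 1)) x :=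
    Real.hasDerivAt_rpow_const (Or.inr hα)
  refine ((hW x).mul h1.neg.exp).congr_deriv ?_
  simp only [Pi.neg_apply]
  ring

/-- The Lyapunov function method: integrate `(W exp (-x^α))'` over the half-line. The boundary
term at infinity has the favourable sign, so that nothing has to be integrable beforehand. -/
theorem lintegral_halfMeasure_le_of_lyapunov {α : ℝ} (hα : 1 ≤ α) {W W' P Q : ℝ → ℝ}
    (hW : ∀ x, HasDerivAt W (W' x) x) (hW0 : ∀ x, 0 ≤ x → 0 ≤ W x)
    (hP : Continuous P) (hP0 : ∀ x, 0 ≤ x → 0 ≤ P x)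
    (hQ : Measurable Q) (hQ0 : ∀ x, 0 ≤ x → 0 ≤ Q x)
    (h : ∀ x, 0 < x → P x + W' x ≤ α * x ^ (α - 1) * W x + Q x) :
    ∫⁻ x, ENNReal.ofReal (P x) ∂(halfMeasure α)
      ≤ ENNReal.ofReal (W 0) + ∫⁻ x, ENNReal.ofReal (Q x) ∂(halfMeasure α) := by
  rw [lintegral_ofReal_halfMeasure hα, lintegral_ofReal_halfMeasure hα]
  by_cases hfin : ∫⁻ x in Ioi 0, ENNReal.ofReal (Q x * Real.exp (-x ^ α)) = ⊤
  · simp [hfin]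
  have hρ := continuous_exp_neg_rpow hα
  have hcover : AECover (volume.restrict (Ioi (0 : ℝ))) atTop fun R : ℝ => Ioc 0 R := by
    refine ⟨(ae_restrict_iff' measurableSet_Ioi).2 (.of_forall fun x hx => ?_),
      fun _ => measurableSet_Ioc⟩
    filter_upwards [eventually_ge_atTop x] with R hR using ⟨hx, hR⟩
  have hlim := hcover.lintegral_tendsto_of_countably_generated
    (f := fun x => ENNReal.ofReal (P x * Real.exp (-x ^ α)))
    ((hP.mul hρ).measurable.ennreal_ofReal.aemeasurable)
  refine le_of_tendsto hlim ?_
  filter_upwards [eventually_ge_atTop 0] with R hR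
  rw [Measure.restrict_restrict measurableSet_Ioc,
    inter_eq_left.2 (Ioc_subset_Ioi_self : Ioc (0 : ℝ) R ⊆ Ioi 0)]
  have hle : ∫⁻ x in Ioc 0 R, ENNReal.ofReal (Q x * Real.exp (-x ^ α))
      ≤ ∫⁻ x in Ioi 0, ENNReal.ofReal (Q x * Real.exp (-x ^ α)) :=
    lintegral_mono_set Ioc_subset_Ioi_self
  have hfin' := ne_top_of_le_ne_top hfin hle
  have key := sub_add_integral_le_toReal hR
    (G := fun x => W x * Real.exp (-x ^ α)) (p := fun x => P x * Real.exp (-x ^ α))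
    (q := fun x => Q x * Real.exp (-x ^ α))
    (fun x _ => (hasDerivAt_mul_exp_neg_rpow hα hW x).continuousAt.continuousWithinAt)
    (fun x _ => hasDerivAt_mul_exp_neg_rpow hα hW x)
    (hP.mul hρ).continuousOn (hQ.mul hρ.measurable)
    (fun x hx => mul_nonneg (hQ0 x hx.1.le) (Real.exp_pos _).le)
    (fun x hx => by
      rw [← add_mul]
      exact mul_le_mul_of_nonneg_right (by linarith [h x hx.1]) (Real.exp_pos _).le) hfin'
  rw [← ofReal_integral_eq_lintegral_ofReal]
  · have hα0 : α ≠ 0 := by linarith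
    have h0 : (0 : ℝ) ≤ W R * Real.exp (-R ^ α) := mul_nonneg (hW0 R hR) (Real.exp_pos _).le
    simp only [Real.zero_rpow hα0, neg_zero, Real.exp_zero, mul_one] at key
    calc _ ≤ ENNReal.ofReal (W 0 + (∫⁻ x in Ioc 0 R,
          ENNReal.ofReal (Q x * Real.exp (-x ^ α))).toReal) :=
          ENNReal.ofReal_le_ofReal (by linarith)
      _ ≤ _ := by
          rw [ENNReal.ofReal_add (hW0 0 le_rfl) ENNReal.toReal_nonneg,
            ENNReal.ofReal_toReal hfin']
          gcongr
  · exact ((hP.mul hρ).continuousOn.integrableOn_Icc).mono_set Ioc_subset_Icc_self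
  · exact (ae_restrict_iff' measurableSet_Ioc).2
      (.of_forall fun x hx => mul_nonneg (hP0 x hx.1.le) (Real.exp_pos _).le)

/-- A one-dimensional Sobolev bound: integrating the derivative of
`y ↦ (x + 1 - y) W y exp (-y^α)` over `[x, x + 1]` bounds `W x exp (-x^α)` by the integral of
`W` and of its weighted derivative. -/
theorem ofReal_mul_exp_le_lintegral {α : ℝ} (hα : 1 ≤ α) {W W' Q : ℝ → ℝ}
    (hW : ∀ x, HasDerivAt W (W' x) x) (hW0 : ∀ x, 0 ≤ x → 0 ≤ W x)
    (hQ : Measurable Q)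
    (h : ∀ x, 0 < x → W x + |W' x| + α * x ^ (α - 1) * W x ≤ Q x) {x : ℝ} (hx : 0 ≤ x) :
    ENNReal.ofReal (W x * Real.exp (-x ^ α))
      ≤ ∫⁻ x, ENNReal.ofReal (Q x) ∂(halfMeasure α) := by
  rw [lintegral_ofReal_halfMeasure hα]
  by_cases hfin : ∫⁻ x in Ioi 0, ENNReal.ofReal (Q x * Real.exp (-x ^ α)) = ⊤
  · simp [hfin]
  have hρ := continuous_exp_neg_rpow hα
  have hle : ∫⁻ y in Ioc x (x + 1), ENNReal.ofReal (Q y * Real.exp (-y ^ α))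
      ≤ ∫⁻ x in Ioi 0, ENNReal.ofReal (Q x * Real.exp (-x ^ α)) :=
    lintegral_mono_set fun y hy => hx.trans_lt hy.1
  have hfin' := ne_top_of_le_ne_top hfin hle
  have hd : ∀ y, HasDerivAt (fun y => (y - (x + 1)) * (W y * Real.exp (-y ^ α)))
      (1 * (W y * Real.exp (-y ^ α)) + (y - (x + 1)) *
        ((W' y - α * y ^ (α - 1) * W y) * Real.exp (-y ^ α))) y := fun y =>
    ((hasDerivAt_id y).sub_const (x + 1)).mul (hasDerivAt_mul_exp_neg_rpow hα hW y)
  have hB : ∀ y, 0 < y → 0 ≤ α * y ^ (α - 1) * W y := fun y hy =>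
    mul_nonneg (mul_nonneg (by linarith) (Real.rpow_nonneg hy.le _)) (hW0 y hy.le)
  have key := sub_add_integral_le_toReal (by linarith : x ≤ x + 1)
    (G := fun y => (y - (x + 1)) * (W y * Real.exp (-y ^ α))) (p := fun _ => 0)
    (q := fun x => Q x * Real.exp (-x ^ α))
    (fun y _ => (hd y).continuousAt.continuousWithinAt) (fun y _ => hd y)
    continuousOn_const (hQ.mul hρ.measurable)
    (fun y hy => by
      have hy0 : 0 < y := hx.trans_lt hy.1
      refine mul_nonneg ?_ (Real.exp_pos _).le
      linarith [h y hy0, hW0 y hy0.le, abs_nonneg (W' y), hB y hy0])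
    (fun y hy => by
      have hy0 : 0 < y := hx.trans_lt hy.1
      rw [zero_add, one_mul, ← mul_assoc, ← add_mul]
      refine mul_le_mul_of_nonneg_right ?_ (Real.exp_pos _).le
      have h1 : |(y - (x + 1)) * (W' y - α * y ^ (α - 1) * W y)|
          ≤ 1 * (|W' y| + α * y ^ (α - 1) * W y) := by
        rw [abs_mul]
        refine mul_le_mul ?_ ?_ (abs_nonneg _) zero_le_one
        · rw [abs_le]; constructor <;> linarith [hy.1, hy.2]
        · refine (abs_sub _ _).trans ?_
          rw [abs_of_nonneg (hB y hy0)]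
      linarith [h y hy0, le_abs_self ((y - (x + 1)) * (W' y - α * y ^ (α - 1) * W y))])
    hfin'
  simp only [sub_self, zero_mul, integral_zero, add_zero] at key
  refine le_trans ?_ hle
  rw [← ENNReal.ofReal_toReal hfin']
  exact ENNReal.ofReal_le_ofReal (by linarith)

/-! ### Pointwise inequalities -/

/-- The nonnegative integrand `s log s - s + 1` of the entropy. -/
noncomputable def entropyFun (s : ℝ) : ℝ := s * Real.log s - s + 1

lemma entropyFun_nonneg {s : ℝ} (hs : 0 ≤ s) : 0 ≤ entropyFun s := by
  unfold entropyFun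
  rcases hs.eq_or_lt with rfl | hs
  · simp
  have h := Real.one_sub_inv_le_log_of_pos hs
  have h2 := mul_le_mul_of_nonneg_left h hs.le
  rw [mul_sub, mul_inv_cancel₀ hs.ne'] at h2
  linarith

/-- Follows from `log |t| ≤ |t| - 1`. -/
lemma entropyFun_sq_le (t : ℝ) : entropyFun (t ^ 2) ≤ (|t| - 1) ^ 2 * (2 * |t| + 1) := by
  unfold entropyFun
  rcases eq_or_ne t 0 with rfl | ht
  · simp
  have h1 : Real.log (t ^ 2) ≤ 2 * (|t| - 1) := by
    rw [Real.log_pow, ← Real.log_abs]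
    push_cast
    linarith [Real.log_le_sub_one_of_pos (abs_pos.2 ht)]
  have h2 := mul_le_mul_of_nonneg_left h1 (sq_nonneg t)
  have h3 := sq_abs t
  rw [← h3] at h2 ⊢
  nlinarith

/-- The positive part raised to an integer power at least two is differentiable. -/
lemma hasDerivAt_max_zero_pow (n : ℕ) (y : ℝ) :
    HasDerivAt (fun y : ℝ => max y 0 ^ (n + 2)) ((n + 2) * max y 0 ^ (n + 1)) y := by
  rcases lt_trichotomy y 0 with hy | rfl | hy
  · have h : (fun y : ℝ => max y 0 ^ (n + 2)) =ᶠ[𝓝 y] fun _ => 0 := by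
      filter_upwards [gt_mem_nhds hy] with z hz
      rw [max_eq_right hz.le, zero_pow (by omega)]
    rw [max_eq_right hy.le, zero_pow (by omega), mul_zero]
    exact (hasDerivAt_const y 0).congr_of_eventuallyEq h
  · have h : (fun y : ℝ => max y 0 ^ (n + 2)) =O[𝓝 0] fun x => ‖x - 0‖ ^ (n + 2) := by
      refine Asymptotics.isBigO_of_le _ fun x => ?_
      rw [norm_pow, norm_pow, norm_norm, sub_zero]
      refine pow_le_pow_left₀ (norm_nonneg _) ?_ _
      rw [Real.norm_of_nonneg (le_max_right x 0), Real.norm_eq_abs]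
      exact max_le (le_abs_self x) (abs_nonneg x)
    have h2 := (h.hasFDerivAt (by omega : 1 < n + 2)).hasDerivAt
    simpa using h2
  · have h : (fun y : ℝ => max y 0 ^ (n + 2)) =ᶠ[𝓝 y] fun y => y ^ (n + 2) := by
      filter_upwards [lt_mem_nhds hy] with z hz
      rw [max_eq_left hz.le]
    rw [max_eq_left hy.le]
    simpa using (hasDerivAt_pow (n + 2) y).congr_of_eventuallyEq h

/-- The profile `η t = (t² - 4)₊ / (1 + t²)`, with values in `[0, 1]`. -/
noncomputable def profile (t : ℝ) : ℝ := max (t ^ 2 - 4) 0 / (1 + t ^ 2)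

lemma profile_nonneg (t : ℝ) : 0 ≤ profile t :=
  div_nonneg (le_max_right _ _) (by positivity)

lemma profile_le_one (t : ℝ) : profile t ≤ 1 := by
  unfold profile
  rw [div_le_one (by positivity)]
  exact max_le (by linarith) (by positivity)

lemma profile_eq_zero {t : ℝ} (ht : |t| ≤ 2) : profile t = 0 := by
  have : t ^ 2 ≤ 4 := by nlinarith [sq_abs t, abs_nonneg t]
  unfold profile
  rw [max_eq_right (by linarith), zero_div]

/-- A `C¹` truncation of `t ↦ t²` that is zero for `|t| ≤ 2`, vanishes to order `n + 2` at
`|t| = 2`, and is comparable to `t²` for `|t| ≥ 4`. The order of vanishing is large enough for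
`|bump'| ^ α ≤ C * bump * |t| ^ (α - 2)` as soon as `(n + 1) α ≥ n + 2`. -/
noncomputable def bump (n : ℕ) (t : ℝ) : ℝ := (1 + t ^ 2) * profile t ^ (n + 2)

/-- The derivative of `bump`. -/
noncomputable def bumpDeriv (n : ℕ) (t : ℝ) : ℝ :=
  2 * t * ((n + 2) * profile t ^ (n + 1) - (n + 1) * profile t ^ (n + 2))

lemma bump_nonneg (n : ℕ) (t : ℝ) : 0 ≤ bump n t :=
  mul_nonneg (by positivity) (pow_nonneg (profile_nonneg t) _)

lemma continuous_profile : Continuous profile := by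
  unfold profile
  exact (by fun_prop : Continuous fun t : ℝ => max (t ^ 2 - 4) 0).div (by fun_prop)
    fun t => by positivity

lemma continuous_bump (n : ℕ) : Continuous (bump n) := by
  unfold bump
  have := continuous_profile
  fun_prop

lemma hasDerivAt_bump (n : ℕ) (t : ℝ) : HasDerivAt (bump n) (bumpDeriv n t) t := by
  have h0 : (1 + t ^ 2) ≠ 0 := by positivity
  have e : bump n = fun t => max (t ^ 2 - 4) 0 ^ (n + 2) / (1 + t ^ 2) ^ (n + 1) := by
    funext s
    have : (1 + s ^ 2) ≠ 0 := by positivity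
    unfold bump profile
    rw [div_pow]
    field_simp
    ring
  rw [e]
  have h1 : HasDerivAt (fun t : ℝ => t ^ 2 - 4) (2 * t) t := by
    simpa using (hasDerivAt_pow 2 t).sub_const 4
  have h2 : HasDerivAt (fun t : ℝ => 1 + t ^ 2) (2 * t) t := by
    simpa using (hasDerivAt_pow 2 t).const_add 1
  have h3 := (hasDerivAt_max_zero_pow n (t ^ 2 - 4)).comp t h1
  have h4 := h3.div (h2.pow (n + 1)) (pow_ne_zero _ h0)
  refine h4.congr_deriv ?_
  unfold bumpDeriv profile
  simp only [Function.comp, Pi.pow_apply, Nat.add_sub_cancel]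
  push_cast
  rw [div_pow, div_pow]
  generalize max (t ^ 2 - 4) 0 = m
  field_simp
  ring

lemma abs_bumpDeriv_le (n : ℕ) (t : ℝ) :
    |bumpDeriv n t| ≤ 2 * (n + 2) * |t| * profile t ^ (n + 1) := by
  have h0 := profile_nonneg t
  have h1 := profile_le_one t
  have h2 : 0 ≤ profile t ^ (n + 1) := pow_nonneg h0 _
  have e : bumpDeriv n t = 2 * t * (profile t ^ (n + 1) * ((n + 2) - (n + 1) * profile t)) := by
    unfold bumpDeriv; ring
  have hn : (0 : ℝ) ≤ n := n.cast_nonneg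
  have h3 : (n + 1) * profile t ≤ n + 1 := by nlinarith
  have h4 : 0 ≤ (n + 1) * profile t := by positivity
  rw [e, abs_mul, abs_mul, abs_mul, abs_two, abs_of_nonneg h2,
    abs_of_nonneg (by linarith : 0 ≤ (n + 2 : ℝ) - (n + 1) * profile t)]
  have h5 : profile t ^ (n + 1) * ((n + 2) - (n + 1) * profile t)
      ≤ profile t ^ (n + 1) * (n + 2) := by gcongr; linarith
  calc _ ≤ 2 * |t| * (profile t ^ (n + 1) * (n + 2)) := by gcongr
    _ = _ := by ring

lemma bump_eq_zero (n : ℕ) {t : ℝ} (ht : |t| ≤ 2) : bump n t = 0 := by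
  simp [bump, profile_eq_zero ht]

lemma bumpDeriv_eq_zero (n : ℕ) {t : ℝ} (ht : |t| ≤ 2) : bumpDeriv n t = 0 := by
  simp [bumpDeriv, profile_eq_zero ht]

lemma bump_le (n : ℕ) (t : ℝ) : bump n t ≤ 5 * (|t| - 1) ^ 2 := by
  rcases le_total |t| 2 with ht | ht
  · rw [bump_eq_zero n ht]; positivity
  · have h1 : profile t ^ (n + 2) ≤ 1 := pow_le_one₀ (profile_nonneg t) (profile_le_one t)
    have h2 : bump n t ≤ 1 + t ^ 2 := mul_le_of_le_one_right (by positivity) h1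
    nlinarith [sq_abs t]

lemma sq_le_bump (n : ℕ) {t : ℝ} (ht : 4 ≤ |t|) : t ^ 2 ≤ 2 ^ (n + 2) * bump n t := by
  have h16 : 16 ≤ t ^ 2 := by nlinarith [sq_abs t]
  have h1 : 1 ≤ 2 * profile t := by
    unfold profile
    rw [max_eq_left (by linarith), ← mul_div_assoc, le_div_iff₀ (by positivity)]
    linarith
  have h2 : 1 ≤ (2 * profile t) ^ (n + 2) := one_le_pow₀ h1
  rw [mul_pow] at h2
  unfold bump
  nlinarith [mul_le_mul_of_nonneg_left h2 (by positivity : 0 ≤ 1 + t ^ 2)]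

/-- The integrand `|f'/f| ^ β f² 1_{|f| ≥ 2}`, as a function of the values `t` of `f` and `d` of
its derivative. -/
noncomputable def gradTerm (β t d : ℝ) : ℝ := if 2 ≤ |t| then |d / t| ^ β * t ^ 2 else 0

lemma gradTerm_nonneg (β t d : ℝ) : 0 ≤ gradTerm β t d := by
  unfold gradTerm
  split_ifs
  · exact mul_nonneg (Real.rpow_nonneg (abs_nonneg _) _) (sq_nonneg _)
  · exact le_rfl

/-- Young's inequality for the derivative of `bump n ∘ f`, with weight `x`. -/
lemma mul_abs_bumpDeriv_mul_le {α β : ℝ} (hαβ : α.HolderConjugate β) {n : ℕ}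
    (hn : (n + 2 : ℝ) ≤ (n + 1) * α) {x : ℝ} (hx : 0 ≤ x) (t d : ℝ) :
    x * |bumpDeriv n t * d|
      ≤ 1 / 2 * (x ^ α * bump n t) + (4 * (n + 2)) ^ β / β * gradTerm β t d := by
  have hα : 1 < α := hαβ.lt
  have hβ0 : 0 < β := hαβ.symm.pos
  have hη0 := profile_nonneg t
  have hη1 := profile_le_one t
  rcases lt_or_ge |t| 2 with ht | ht
  · rw [bumpDeriv_eq_zero n ht.le, bump_eq_zero n ht.le]
    simp [gradTerm, not_le.2 ht]
  have ht0 : t ≠ 0 := by rintro rfl; norm_num at ht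
  have hn0 : (0 : ℝ) ≤ n := n.cast_nonneg
  have hd : |d| = |t| * |d / t| := by rw [← abs_mul, mul_div_cancel₀ _ ht0]
  have hg : gradTerm β t d = |d / t| ^ β * t ^ 2 := if_pos ht
  set η := profile t
  set r := |d / t| with hr
  have hr0 : 0 ≤ r := abs_nonneg _
  have hηn : 0 ≤ η ^ (n + 1) := pow_nonneg hη0 _
  have hY := Real.young_inequality_of_nonneg
    (a := x * η ^ (n + 1) * (1 / 2)) (b := 4 * (n + 2) * r) (by positivity) (by positivity) hαβ
  -- the power of `η` produced by Young's inequality is at most the one in `bump`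
  have hA : (x * η ^ (n + 1) * (1 / 2)) ^ α / α ≤ 1 / 2 * (x ^ α * η ^ (n + 2)) := by
    have h1 : (η ^ (n + 1)) ^ α ≤ η ^ (n + 2) := by
      rw [← Real.rpow_natCast, ← Real.rpow_mul hη0, ← Real.rpow_natCast]
      push_cast
      exact Real.rpow_le_rpow_of_exponent_ge' hη0 hη1 (by positivity) hn
    have h2 : (1 / 2 : ℝ) ^ α ≤ 1 / 2 := by
      simpa using Real.rpow_le_rpow_of_exponent_ge (by norm_num : (0 : ℝ) < 1 / 2)
        (by norm_num) hα.le
    rw [Real.mul_rpow (by positivity) (by norm_num), Real.mul_rpow hx hηn]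
    have hxα : 0 ≤ x ^ α := Real.rpow_nonneg hx _
    have h3 : x ^ α * (η ^ (n + 1)) ^ α * (1 / 2) ^ α ≤ x ^ α * η ^ (n + 2) * (1 / 2) := by
      gcongr
    refine (div_le_self ?_ hα.le).trans (h3.trans (by linarith))
    exact mul_nonneg (mul_nonneg hxα (Real.rpow_nonneg hηn _)) (by positivity)
  have hB : (4 * (n + 2) * r) ^ β = (4 * (n + 2)) ^ β * r ^ β :=
    Real.mul_rpow (by positivity) hr0
  rw [hB] at hY
  have hP : x * |bumpDeriv n t * d| ≤ t ^ 2 * (x * η ^ (n + 1) * (1 / 2) * (4 * (n + 2) * r)) := by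
    rw [abs_mul, hd, ← sq_abs t]
    calc x * (|bumpDeriv n t| * (|t| * r))
        ≤ x * ((2 * (n + 2) * |t| * η ^ (n + 1)) * (|t| * r)) := by
          gcongr; exact abs_bumpDeriv_le n t
      _ = _ := by ring
  have hQ : t ^ 2 * (x ^ α * η ^ (n + 2)) ≤ x ^ α * bump n t := by
    unfold bump
    have : 0 ≤ x ^ α * η ^ (n + 2) := mul_nonneg (Real.rpow_nonneg hx _) (pow_nonneg hη0 _)
    nlinarith
  rw [hg]
  calc x * |bumpDeriv n t * d|
      ≤ t ^ 2 * (1 / 2 * (x ^ α * η ^ (n + 2)) + (4 * (n + 2)) ^ β * r ^ β / β) :=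
        hP.trans (mul_le_mul_of_nonneg_left (hY.trans (by linarith)) (sq_nonneg t))
    _ = 1 / 2 * (t ^ 2 * (x ^ α * η ^ (n + 2))) + (4 * (n + 2)) ^ β / β * (r ^ β * t ^ 2) := by
        ring
    _ ≤ _ := by linarith

/-! ### Functional inequalities on the half-line -/

lemma lintegral_ofReal_const_mul {X : Type*} [MeasurableSpace X] (μ : Measure X) {c : ℝ}
    (hc : 0 ≤ c) (F : X → ℝ) :
    ∫⁻ x, ENNReal.ofReal (c * F x) ∂μ = ENNReal.ofReal c * ∫⁻ x, ENNReal.ofReal (F x) ∂μ := by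
  simp_rw [ENNReal.ofReal_mul hc]
  exact lintegral_const_mul' _ _ ENNReal.ofReal_ne_top

lemma lintegral_ofReal_add {X : Type*} [MeasurableSpace X] (μ : Measure X) {F G : X → ℝ}
    (hF : Measurable F) (hF0 : ∀ x, 0 ≤ F x) (hG0 : ∀ x, 0 ≤ G x) :
    ∫⁻ x, ENNReal.ofReal (F x + G x) ∂μ
      = ∫⁻ x, ENNReal.ofReal (F x) ∂μ + ∫⁻ x, ENNReal.ofReal (G x) ∂μ := by
  rw [← lintegral_add_left hF.ennreal_ofReal]
  exact lintegral_congr fun x => ENNReal.ofReal_add (hF0 x) (hG0 x)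

lemma measurable_gradTerm {β : ℝ} {f : ℝ → ℝ} (hf : ContDiff ℝ 1 f) :
    Measurable fun x => gradTerm β (f x) (deriv f x) := by
  unfold gradTerm
  have h1 := hf.continuous.measurable
  have h2 := (hf.continuous_deriv le_rfl).measurable
  refine Measurable.ite (measurableSet_le measurable_const h1.abs) ?_ measurable_const
  exact ((h2.div h1).abs.pow_const _).mul (h1.pow_const 2)

/-- The Poincaré inequality on the half-line. The Lyapunov weight `1 + exp (-x)` supplies the
spectral gap near the origin, where the potential `x^α` is flat. -/
theorem poincare_halfMeasure {α : ℝ} (hα : 1 ≤ α) {f : ℝ → ℝ} (hf : ContDiff ℝ 1 f) :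
    ∫⁻ x, ENNReal.ofReal ((f x - f 0) ^ 2) ∂(halfMeasure α)
      ≤ ∫⁻ x, ENNReal.ofReal (144 * deriv f x ^ 2) ∂(halfMeasure α) := by
  have hd : ∀ x, HasDerivAt f (deriv f x) x := fun x =>
    (hf.differentiable one_ne_zero x).hasDerivAt
  have hc := hf.continuous
  have hc' := hf.continuous_deriv le_rfl
  have h := lintegral_halfMeasure_le_of_lyapunov hα
    (W := fun x => 6 * ((1 + Real.exp (-x)) * (f x - f 0) ^ 2))
    (W' := fun x => 6 * (-Real.exp (-x) * (f x - f 0) ^ 2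
      + (1 + Real.exp (-x)) * (2 * (f x - f 0) * deriv f x)))
    (P := fun x => (f x - f 0) ^ 2) (Q := fun x => 144 * deriv f x ^ 2)
    (fun x => by
      have h1 : HasDerivAt (fun x => 1 + Real.exp (-x)) (-Real.exp (-x)) x := by
        simpa using ((hasDerivAt_neg x).exp).const_add 1
      have h2 : HasDerivAt (fun x => (f x - f 0) ^ 2) (2 * (f x - f 0) * deriv f x) x := by
        simpa using ((hd x).sub_const (f 0)).fun_pow 2
      exact (h1.mul h2).const_mul 6)
    (fun x _ => by positivity) (by fun_prop) (fun x _ => by positivity)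
    (by fun_prop) (fun x _ => by positivity)
    (fun x hx => by
      set g := f x - f 0
      set e := Real.exp (-x)
      have he0 : 0 < e := Real.exp_pos _
      have he1 : e ≤ 1 := Real.exp_le_one_iff.2 (by linarith)
      have hU0 : 0 ≤ α * x ^ (α - 1) := mul_nonneg (by linarith) (Real.rpow_nonneg hx.le _)
      have hgap : 1 / 3 ≤ α * x ^ (α - 1) * (1 + e) + e := by
        rcases le_total x 1 with h1 | h1
        · have : 1 / 3 ≤ e := by
            have h2 : Real.exp (-1) ≤ e := Real.exp_le_exp.2 (by linarith)
            have h3 := Real.exp_neg_one_gt_d9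
            linarith
          nlinarith
        · have h2 : 1 ≤ x ^ (α - 1) := Real.one_le_rpow h1 (by linarith)
          nlinarith
      have hY : -((1 + e) * (2 * g * deriv f x)) ≤ 1 / 6 * g ^ 2 + 24 * deriv f x ^ 2 ∧
          (1 + e) * (2 * g * deriv f x) ≤ 1 / 6 * g ^ 2 + 24 * deriv f x ^ 2 := by
        have h4 : (1 + e) ^ 2 ≤ 4 := by nlinarith
        constructor <;>
        nlinarith [sq_nonneg (g + 6 * (1 + e) * deriv f x),
          sq_nonneg (g - 6 * (1 + e) * deriv f x), mul_le_mul_of_nonneg_right h4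
            (sq_nonneg (deriv f x))]
      have := mul_le_mul_of_nonneg_right hgap (sq_nonneg g)
      nlinarith [hY.2])
  simpa using h

/-- The entropy bound for `1 < α ≤ 2` on the half-line: `bump n ∘ f` satisfies the moment bound
`∫ x^α bump ≤ 2 T` and the uniform bound `bump * exp (-x^α) ≤ 8 T`, where `T` is the integral on
the right-hand side, and `log (f²) ≤ f² exp (-x^α) + x^α` turns these into a bound on the
entropy. -/
theorem lintegral_entropyFun_halfMeasure_le {α β : ℝ} (hαβ : α.HolderConjugate β) (hα2 : α ≤ 2)
    {n : ℕ} (hn : (n + 2 : ℝ) ≤ (n + 1) * α) {f : ℝ → ℝ} (hf : ContDiff ℝ 1 f) {M : ℝ≥0∞}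
    (hM : ∫⁻ x, ENNReal.ofReal (f x ^ 2) ∂(halfMeasure α) ≤ M) :
    ∫⁻ x, ENNReal.ofReal (entropyFun (f x ^ 2)) ∂(halfMeasure α)
      ≤ (2 + 2 ^ (n + 2) * (8 * M + 2)) *
        ∫⁻ x, ENNReal.ofReal (5 * (|f x| - 1) ^ 2
          + (4 * (n + 2)) ^ β / β * gradTerm β (f x) (deriv f x)) ∂(halfMeasure α) := by
  have hα : 1 ≤ α := hαβ.lt.le
  have hβ0 : 0 < β := hαβ.symm.pos
  set c : ℝ := (4 * (n + 2)) ^ β / β with hc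
  have hc0 : 0 ≤ c := div_nonneg (Real.rpow_nonneg (by positivity) _) hβ0.le
  set q : ℝ → ℝ := fun x => 5 * (|f x| - 1) ^ 2 + c * gradTerm β (f x) (deriv f x) with hq
  set T : ℝ≥0∞ := ∫⁻ x, ENNReal.ofReal (q x) ∂(halfMeasure α)
  have hfc := hf.continuous
  have hwc : Continuous fun x => bump n (f x) := (continuous_bump n).comp hfc
  have hD0 : ∀ x, 0 ≤ c * gradTerm β (f x) (deriv f x) := fun x =>
    mul_nonneg hc0 (gradTerm_nonneg _ _ _)
  have hq0 : ∀ x, 0 ≤ q x := fun x => add_nonneg (by positivity) (hD0 x)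
  have hqm : Measurable q :=
    (by fun_prop : Continuous fun x => 5 * (|f x| - 1) ^ 2).measurable.add
      ((measurable_gradTerm hf).const_mul c)
  have hw : ∀ x, HasDerivAt (fun x => bump n (f x)) (bumpDeriv n (f x) * deriv f x) x :=
    fun x => (hasDerivAt_bump n (f x)).comp x
      (hf.differentiable one_ne_zero x).hasDerivAt
  have hwq : ∀ x, bump n (f x) + c * gradTerm β (f x) (deriv f x) ≤ q x := fun x => by
    simp only [hq]; gcongr; exact bump_le n (f x)
  set p : ℝ → ℝ := fun x => 1 / 2 * (|x| ^ α * bump n (f x)) with hp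
  have hpc : Continuous p := by
    have : Continuous fun x : ℝ => |x| ^ α :=
      (Real.continuous_rpow_const (by linarith)).comp continuous_abs
    fun_prop
  have hp0 : ∀ x, 0 ≤ p x := fun x =>
    mul_nonneg (by norm_num) (mul_nonneg (Real.rpow_nonneg (abs_nonneg x) _) (bump_nonneg n _))
  have hmoment : ∫⁻ x, ENNReal.ofReal (p x) ∂(halfMeasure α) ≤ T := by
    have h := lintegral_halfMeasure_le_of_lyapunov hα (W := fun x => x * bump n (f x))
      (W' := fun x => 1 * bump n (f x) + x * (bumpDeriv n (f x) * deriv f x)) (P := p) (Q := q)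
      (fun x => (hasDerivAt_id x).mul (hw x)) (fun x hx => mul_nonneg hx (bump_nonneg n _))
      hpc (fun x _ => hp0 x) hqm (fun x _ => hq0 x)
      (fun x hx => by
        have h1 := mul_abs_bumpDeriv_mul_le hαβ hn hx.le (f x) (deriv f x)
        have h2 : x * (bumpDeriv n (f x) * deriv f x) ≤ x * |bumpDeriv n (f x) * deriv f x| :=
          mul_le_mul_of_nonneg_left (le_abs_self _) hx.le
        have h3 : x ^ (α - 1) * x = x ^ α := by
          rw [← Real.rpow_add_one hx.ne', sub_add_cancel]
        have h4 : 0 ≤ x ^ α * bump n (f x) :=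
          mul_nonneg (Real.rpow_nonneg hx.le _) (bump_nonneg n _)
        have h5 : α * x ^ (α - 1) * (x * bump n (f x)) = α * (x ^ α * bump n (f x)) := by
          rw [← h3]; ring
        have h6 : x ^ α * bump n (f x) ≤ α * (x ^ α * bump n (f x)) := by nlinarith
        simp only [hp, abs_of_pos hx]
        rw [h5]
        linarith [hwq x])
    simpa using h
  have hsup : ∀ x, 0 ≤ x →
      ENNReal.ofReal (bump n (f x) * Real.exp (-x ^ α)) ≤ 8 * T := fun x hx => by
    refine (ofReal_mul_exp_le_lintegral hα (W := fun x => bump n (f x)) hw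
      (fun x _ => bump_nonneg n _) (Q := fun x => 4 * q x + 4 * p x)
      ((hqm.const_mul 4).add (hpc.measurable.const_mul 4)) (fun x hx => ?_) hx).trans ?_
    · have h1 := mul_abs_bumpDeriv_mul_le hαβ hn zero_le_one (f x) (deriv f x)
      rw [Real.one_rpow, one_mul, one_mul] at h1
      have h2 : x ^ (α - 1) ≤ 1 + x ^ α := by
        have hxα := Real.rpow_nonneg hx.le α
        rcases le_total x 1 with hx1 | hx1
        · linarith [Real.rpow_le_one hx.le hx1 (by linarith : 0 ≤ α - 1)]
        · linarith [Real.rpow_le_rpow_of_exponent_le hx1 (by linarith : α - 1 ≤ α)]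
      have h3 : α * x ^ (α - 1) ≤ 2 * (1 + x ^ α) :=
        mul_le_mul hα2 h2 (Real.rpow_nonneg hx.le _) (by norm_num)
      have h4 := mul_le_mul_of_nonneg_right h3 (bump_nonneg n (f x))
      simp only [hp, abs_of_pos hx]
      linarith [hwq x, bump_nonneg n (f x), hD0 x]
    · rw [lintegral_ofReal_add _ (hqm.const_mul 4) (fun x => mul_nonneg (by norm_num) (hq0 x))
        (fun x => mul_nonneg (by norm_num) (hp0 x)),
        lintegral_ofReal_const_mul _ (by norm_num), lintegral_ofReal_const_mul _ (by norm_num),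
        ENNReal.ofReal_ofNat]
      calc _ ≤ 4 * T + 4 * T := by gcongr
        _ = 8 * T := by ring
  have hpoint : ∀ x, 0 < x → ENNReal.ofReal (entropyFun (f x ^ 2))
      ≤ ENNReal.ofReal (2 * q x) + (2 ^ (n + 2) * (8 * T) * ENNReal.ofReal (f x ^ 2)
        + 2 ^ (n + 2) * 2 * ENNReal.ofReal (p x)) := fun x hx => by
    rcases le_total |f x| 4 with h4 | h4
    · refine le_trans (ENNReal.ofReal_le_ofReal ?_) le_self_add
      have h1 : (|f x| - 1) ^ 2 * (2 * |f x| + 1) ≤ (|f x| - 1) ^ 2 * 9 := by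
        gcongr; linarith
      simp only [hq]
      linarith [entropyFun_sq_le (f x), hD0 x, sq_nonneg (|f x| - 1)]
    · refine le_trans ?_ le_add_self
      have hK := sq_le_bump n h4
      have hf16 : 16 ≤ f x ^ 2 := by nlinarith [sq_abs (f x)]
      have hρ := Real.exp_pos (-x ^ α)
      have hlog : Real.log (f x ^ 2) ≤ f x ^ 2 * Real.exp (-x ^ α) + x ^ α := by
        have h1 := Real.log_le_sub_one_of_pos (mul_pos (by linarith : 0 < f x ^ 2) hρ)
        rw [Real.log_mul (by linarith) hρ.ne', Real.log_exp] at h1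
        linarith
      have hreal : entropyFun (f x ^ 2)
          ≤ 2 ^ (n + 2) * ((bump n (f x) * Real.exp (-x ^ α)) * f x ^ 2)
            + 2 ^ (n + 2) * 2 * p x := by
        have hxα := Real.rpow_nonneg hx.le α
        have h1 := mul_le_mul_of_nonneg_left hlog (sq_nonneg (f x))
        have h2 : f x ^ 2 * (f x ^ 2 * Real.exp (-x ^ α))
            ≤ f x ^ 2 * ((2 ^ (n + 2) * bump n (f x)) * Real.exp (-x ^ α)) := by gcongr
        have h3 : f x ^ 2 * x ^ α ≤ (2 ^ (n + 2) * bump n (f x)) * x ^ α := by gcongr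
        simp only [hp, abs_of_pos hx]
        unfold entropyFun
        linarith
      refine (ENNReal.ofReal_le_ofReal hreal).trans ?_
      have hw0 := bump_nonneg n (f x)
      have hK0 : (0 : ℝ) ≤ 2 ^ (n + 2) := by positivity
      rw [ENNReal.ofReal_add (by positivity) (mul_nonneg (by positivity) (hp0 x)),
        ENNReal.ofReal_mul hK0, ENNReal.ofReal_mul (by positivity), ENNReal.ofReal_mul
          (by positivity : (0 : ℝ) ≤ 2 ^ (n + 2) * 2), ENNReal.ofReal_mul hK0,
        ENNReal.ofReal_pow (by norm_num), ENNReal.ofReal_ofNat, ← mul_assoc]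
      gcongr
      exact hsup x hx.le
  refine (lintegral_halfMeasure_mono hα hpoint).trans ?_
  have hmf : Measurable fun x => ENNReal.ofReal (f x ^ 2) :=
    (hfc.pow 2).measurable.ennreal_ofReal
  rw [lintegral_add_left (hqm.const_mul 2).ennreal_ofReal,
    lintegral_add_left (hmf.const_mul _), lintegral_const_mul _ hmf,
    lintegral_const_mul _ hpc.measurable.ennreal_ofReal,
    lintegral_ofReal_const_mul _ (by norm_num), ENNReal.ofReal_ofNat]
  calc _ ≤ 2 * T + (2 ^ (n + 2) * (8 * T) * M + 2 ^ (n + 2) * 2 * T) := by gcongr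
    _ = _ := by ring

/-- The entropy bound for the exponential measure on the half-line. The Lyapunov function is
`4 (f² - 4)₊²`; its value at the origin, which has degree four in `f`, is controlled by the
one-dimensional Sobolev bound for `bump 0 ∘ f` and by the a priori bound `M`. -/
theorem lintegral_entropyFun_halfMeasure_one_le {f : ℝ → ℝ} (hf : ContDiff ℝ 1 f)
    (hf' : ∀ x, |deriv f x| ≤ 1 + |f x| / 12) {M : ℝ≥0∞}
    (hM : ∫⁻ x, ENNReal.ofReal ((|f x| - 1) ^ 2) ∂(halfMeasure 1) ≤ M) :
    ∫⁻ x, ENNReal.ofReal (entropyFun (f x ^ 2)) ∂(halfMeasure 1)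
      ≤ (289 + 88 * (17 + 88 * M)) *
        ∫⁻ x, ENNReal.ofReal ((|f x| - 1) ^ 2) ∂(halfMeasure 1) := by
  have hfc := hf.continuous
  have hd : ∀ x, HasDerivAt f (deriv f x) x := fun x =>
    (hf.differentiable one_ne_zero x).hasDerivAt
  set X : ℝ≥0∞ := ∫⁻ x, ENNReal.ofReal ((|f x| - 1) ^ 2) ∂(halfMeasure 1)
  have hqc : Continuous fun x => (|f x| - 1) ^ 2 := by fun_prop
  have hbump0 : ENNReal.ofReal (bump 0 (f 0)) ≤ 22 * X := by
    have h := ofReal_mul_exp_le_lintegral le_rfl (W := fun x => bump 0 (f x))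
      (W' := fun x => bumpDeriv 0 (f x) * deriv f x) (Q := fun x => 22 * (|f x| - 1) ^ 2)
      (fun x => (hasDerivAt_bump 0 (f x)).comp x (hd x)) (fun x _ => bump_nonneg 0 _)
      (hqc.measurable.const_mul 22) (fun x hx => by
        have h1 : |bumpDeriv 0 (f x) * deriv f x| ≤ 12 * (|f x| - 1) ^ 2 := by
          rcases le_total |f x| 2 with h2 | h2
          · rw [bumpDeriv_eq_zero 0 h2, zero_mul, abs_zero]; positivity
          · have h3 := abs_bumpDeriv_le 0 (f x)
            have h4 : |bumpDeriv 0 (f x)| ≤ 4 * |f x| := by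
              have h5 := profile_le_one (f x)
              have h6 : |f x| * profile (f x) ≤ |f x| := mul_le_of_le_one_right (abs_nonneg _) h5
              norm_num at h3
              linarith
            rw [abs_mul]
            calc _ ≤ 4 * |f x| * (1 + |f x| / 12) :=
                  mul_le_mul h4 (hf' x) (abs_nonneg _) (by positivity)
              _ ≤ _ := by nlinarith
        have h2 := bump_le 0 (f x)
        simp only [sub_self, Real.rpow_zero]
        linarith) le_rfl
    rw [lintegral_ofReal_const_mul _ (by norm_num)] at h
    simpa using h
  set F : ℝ → ℝ := fun x => max (f x ^ 2 - 4) 0 ^ 2 with hF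
  have hFc : Continuous F := by fun_prop
  have hF0 : ENNReal.ofReal (4 * F 0) ≤ 88 * (17 + 88 * M) * X := by
    have h1 : F 0 ≤ bump 0 (f 0) * (17 + 4 * bump 0 (f 0)) := by
      have h2 : F 0 = bump 0 (f 0) * (1 + f 0 ^ 2) := by
        have h0 : 1 + f 0 ^ 2 ≠ 0 := by positivity
        simp only [hF, bump, profile, div_pow]
        field_simp
        ring
      rw [h2]
      have h3 := bump_nonneg 0 (f 0)
      refine mul_le_mul_of_nonneg_left ?_ h3
      rcases le_total |f 0| 4 with h4 | h4
      · nlinarith [sq_abs (f 0), abs_nonneg (f 0)]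
      · have := sq_le_bump 0 h4
        norm_num at this
        linarith
    have h3 := bump_nonneg 0 (f 0)
    calc ENNReal.ofReal (4 * F 0)
        ≤ ENNReal.ofReal (4 * (bump 0 (f 0) * (17 + 4 * bump 0 (f 0)))) :=
          ENNReal.ofReal_le_ofReal (by linarith)
      _ = 4 * (ENNReal.ofReal (bump 0 (f 0)) * (17 + 4 * ENNReal.ofReal (bump 0 (f 0)))) := by
          rw [ENNReal.ofReal_mul (by norm_num), ENNReal.ofReal_mul h3,
            ENNReal.ofReal_add (by norm_num) (by positivity), ENNReal.ofReal_mul (by norm_num)]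
          simp
      _ ≤ 4 * (22 * X * (17 + 4 * (22 * M))) := by
          gcongr
          exact hbump0.trans (by gcongr)
      _ = _ := by ring
  have hFint : ∫⁻ x, ENNReal.ofReal (F x) ∂(halfMeasure 1)
      ≤ ENNReal.ofReal (4 * F 0) + 280 * X := by
    have h := lintegral_halfMeasure_le_of_lyapunov le_rfl (W := fun x => 4 * F x)
      (W' := fun x => 4 * (2 * max (f x ^ 2 - 4) 0 * (2 * f x * deriv f x)))
      (P := F) (Q := fun x => 280 * (|f x| - 1) ^ 2)
      (fun x => by
        have h1 : HasDerivAt (fun x => f x ^ 2 - 4) (2 * f x * deriv f x) x := by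
          simpa using ((hd x).pow 2).sub_const 4
        have h2 := (hasDerivAt_max_zero_pow 0 (f x ^ 2 - 4)).comp x h1
        simpa [Function.comp_def, hF] using h2.const_mul 4)
      (fun x _ => by positivity) hFc (fun x _ => by positivity)
      (hqc.measurable.const_mul 280) (fun x _ => by positivity) (fun x hx => by
        have hs := sq_abs (f x)
        simp only [hF, sub_self, Real.rpow_zero]
        rcases le_total |f x| 2 with h2 | h2
        · have : f x ^ 2 - 4 ≤ 0 := by nlinarith [abs_nonneg (f x)]
          rw [max_eq_right this]
          nlinarith [sq_nonneg (|f x| - 1)]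
        · have hk : 0 ≤ f x ^ 2 - 4 := by nlinarith
          rw [max_eq_left hk]
          set k := f x ^ 2 - 4 with hkdef
          set t := |f x|
          have h3 : f x * deriv f x ≤ t * (1 + t / 12) :=
            (le_abs_self _).trans (by
              rw [abs_mul]; exact mul_le_mul_of_nonneg_left (hf' x) (abs_nonneg _))
          have h4 := mul_le_mul_of_nonneg_left h3 hk
          have h5 : t ^ 2 = k + 4 := by linarith
          have h6 : t ^ 2 ≤ 4 * (t - 1) ^ 2 := by nlinarith
          have h7 : k * (t * (1 + t / 12)) = k * t + k * (k + 4) / 12 := by rw [← h5]; ring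
          nlinarith [sq_nonneg (k - 8 * t)])
    rw [lintegral_ofReal_const_mul _ (by norm_num)] at h
    simpa using h
  have hpoint : ∀ x, entropyFun (f x ^ 2) ≤ 9 * (|f x| - 1) ^ 2 + F x := fun x => by
    refine (entropyFun_sq_le _).trans ?_
    have hF0 : 0 ≤ F x := sq_nonneg _
    rcases le_total |f x| 4 with h4 | h4
    · nlinarith [mul_nonneg (sq_nonneg (|f x| - 1)) (sub_nonneg.2 h4)]
    · have hs := sq_abs (f x)
      simp only [hF]
      set t := |f x|
      rw [← hs, max_eq_left (by nlinarith)]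
      have h1 : (t - 1) ^ 2 ≤ t ^ 2 := by nlinarith
      have h2 : 2 * t + 1 ≤ 9 / 16 * t ^ 2 := by nlinarith
      have h3 : 3 / 4 * t ^ 2 ≤ t ^ 2 - 4 := by nlinarith
      have h4 : (3 / 4 * t ^ 2) ^ 2 ≤ (t ^ 2 - 4) ^ 2 := by gcongr
      have h5 : (t - 1) ^ 2 * (2 * t + 1) ≤ t ^ 2 * (9 / 16 * t ^ 2) := by gcongr
      nlinarith [sq_nonneg (t - 1)]
  calc ∫⁻ x, ENNReal.ofReal (entropyFun (f x ^ 2)) ∂(halfMeasure 1)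
      ≤ ∫⁻ x, ENNReal.ofReal (9 * (|f x| - 1) ^ 2 + F x) ∂(halfMeasure 1) :=
        lintegral_mono fun x => ENNReal.ofReal_le_ofReal (hpoint x)
    _ = 9 * X + ∫⁻ x, ENNReal.ofReal (F x) ∂(halfMeasure 1) := by
        rw [lintegral_ofReal_add _ (hqc.measurable.const_mul 9) (fun x => by positivity)
          (fun x => sq_nonneg _), lintegral_ofReal_const_mul _ (by norm_num),
          ENNReal.ofReal_ofNat]
    _ ≤ 9 * X + (88 * (17 + 88 * M) * X + 280 * X) := by
        gcongr
        exact hFint.trans (by gcongr)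
    _ = _ := by ring

/-! ### From the half-line to the line -/

lemma lintegral_eq_Ioi_add_Ioi_neg (F : ℝ → ℝ≥0∞) :
    ∫⁻ x, F x = (∫⁻ x in Ioi 0, F x) + ∫⁻ x in Ioi 0, F (-x) := by
  have h1 : ∫⁻ x in Iio 0, F x = ∫⁻ x in Ioi 0, F (-x) := by
    have h := (Measure.measurePreserving_neg (volume : Measure ℝ)).setLIntegral_comp_preimage_emb
      (MeasurableEquiv.neg ℝ).measurableEmbedding F (Iio 0)
    rw [← h]
    congr 2
    ext x
    simp
  rw [← h1, ← setLIntegral_congr Iio_ae_eq_Iic.symm, ← lintegral_add_compl F measurableSet_Ioi,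
    compl_Ioi]

lemma continuous_exp_neg_abs_rpow {α : ℝ} (hα : 1 ≤ α) :
    Continuous fun x : ℝ => Real.exp (-|x| ^ α) :=
  (continuous_exp_neg_rpow hα).comp continuous_abs

lemma integrable_exp_neg_abs_rpow {α : ℝ} (hα : 1 ≤ α) :
    Integrable fun x : ℝ => Real.exp (-|x| ^ α) := by
  rw [← lintegral_ofReal_ne_top_iff_integrable
    (continuous_exp_neg_abs_rpow hα).aestronglyMeasurable
    (.of_forall fun x => (Real.exp_pos _).le), lintegral_eq_Ioi_add_Ioi_neg]
  simp only [abs_neg, ne_eq, ENNReal.add_eq_top, or_self]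
  have h := integrableOn_rpow_mul_exp_neg_rpow (p := α) (s := 0) (by norm_num) (by linarith)
  have e : ∫⁻ x in Ioi 0, ENNReal.ofReal (Real.exp (-|x| ^ α))
      = ∫⁻ x in Ioi 0, ENNReal.ofReal (x ^ (0 : ℝ) * Real.exp (-x ^ α)) :=
    setLIntegral_congr_fun measurableSet_Ioi fun x hx => by
      simp [abs_of_pos (mem_Ioi.1 hx)]
  rw [e]
  exact h.lintegral_lt_top.ne

lemma partitionZ_pos {α : ℝ} (hα : 1 ≤ α) : 0 < partitionZ α :=
  integral_exp_pos (integrable_exp_neg_abs_rpow hα)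

lemma isProbabilityMeasure_muAlpha {α : ℝ} (hα : 1 ≤ α) :
    IsProbabilityMeasure (muAlpha α) := by
  have hZ := partitionZ_pos hα
  constructor
  unfold muAlpha
  rw [withDensity_apply _ MeasurableSet.univ, Measure.restrict_univ,
    ← ofReal_integral_eq_lintegral_ofReal ((integrable_exp_neg_abs_rpow hα).div_const _)
      (.of_forall fun x => div_nonneg (Real.exp_pos _).le hZ.le), integral_div]
  rw [show ∫ x : ℝ, Real.exp (-|x| ^ α) = partitionZ α from rfl, div_self hZ.ne',
    ENNReal.ofReal_one]

/-- `muAlpha α` is, up to normalisation, the sum of `halfMeasure α` and its reflection. -/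
lemma lintegral_muAlpha {α : ℝ} (hα : 1 ≤ α) (F : ℝ → ℝ≥0∞) :
    ENNReal.ofReal (partitionZ α) * ∫⁻ x, F x ∂(muAlpha α)
      = (∫⁻ x, F x ∂(halfMeasure α)) + ∫⁻ x, F (-x) ∂(halfMeasure α) := by
  have hZ := partitionZ_pos hα
  unfold muAlpha
  rw [lintegral_withDensity_eq_lintegral_mul_non_measurable _
    ((continuous_exp_neg_abs_rpow hα).div_const _).measurable.ennreal_ofReal (by simp),
    ← lintegral_const_mul' _ _ ENNReal.ofReal_ne_top, lintegral_eq_Ioi_add_Ioi_neg,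
    lintegral_halfMeasure hα, lintegral_halfMeasure hα]
  congr 1 <;>
  · refine setLIntegral_congr_fun measurableSet_Ioi fun x hx => ?_
    simp only [Pi.mul_apply, abs_neg, abs_of_pos (mem_Ioi.1 hx)]
    rw [← mul_assoc, ← ENNReal.ofReal_mul hZ.le, mul_div_cancel₀ _ hZ.ne']

lemma lintegral_muAlpha_le {α : ℝ} (hα : 1 ≤ α) {F G : ℝ → ℝ≥0∞} {C : ℝ≥0∞}
    (h1 : ∫⁻ x, F x ∂(halfMeasure α) ≤ C * ∫⁻ x, G x ∂(halfMeasure α))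
    (h2 : ∫⁻ x, F (-x) ∂(halfMeasure α) ≤ C * ∫⁻ x, G (-x) ∂(halfMeasure α)) :
    ∫⁻ x, F x ∂(muAlpha α) ≤ C * ∫⁻ x, G x ∂(muAlpha α) := by
  have hZ := partitionZ_pos hα
  have h0 : ENNReal.ofReal (partitionZ α) ≠ 0 := by simpa using hZ
  rw [← ENNReal.mul_le_mul_iff_right h0 ENNReal.ofReal_ne_top, lintegral_muAlpha hα,
    mul_left_comm, lintegral_muAlpha hα, mul_add]
  exact add_le_add h1 h2

lemma contDiff_comp_neg {f : ℝ → ℝ} (hf : ContDiff ℝ 1 f) : ContDiff ℝ 1 fun x => f (-x) :=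
  hf.comp contDiff_neg

theorem poincare_muAlpha {α : ℝ} (hα : 1 ≤ α) {f : ℝ → ℝ} (hf : ContDiff ℝ 1 f) :
    ∫⁻ x, ENNReal.ofReal ((f x - f 0) ^ 2) ∂(muAlpha α)
      ≤ ∫⁻ x, ENNReal.ofReal (144 * deriv f x ^ 2) ∂(muAlpha α) := by
  have h := lintegral_muAlpha_le hα (F := fun x => ENNReal.ofReal ((f x - f 0) ^ 2))
    (G := fun x => ENNReal.ofReal (144 * deriv f x ^ 2)) (C := 1)
    (by simpa using poincare_halfMeasure hα hf)
    (by simpa [deriv_comp_neg] using poincare_halfMeasure hα (contDiff_comp_neg hf))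
  simpa using h

lemma gradTerm_neg (β t d : ℝ) : gradTerm β t (-d) = gradTerm β t d := by
  simp [gradTerm, neg_div]

theorem lintegral_entropyFun_muAlpha_le {α β : ℝ} (hαβ : α.HolderConjugate β) (hα2 : α ≤ 2)
    {n : ℕ} (hn : (n + 2 : ℝ) ≤ (n + 1) * α) {f : ℝ → ℝ} (hf : ContDiff ℝ 1 f)
    (hf1 : ∫⁻ x, ENNReal.ofReal (f x ^ 2) ∂(muAlpha α) = 1) :
    ∫⁻ x, ENNReal.ofReal (entropyFun (f x ^ 2)) ∂(muAlpha α)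
      ≤ (2 + 2 ^ (n + 2) * (8 * ENNReal.ofReal (partitionZ α) + 2)) *
        ∫⁻ x, ENNReal.ofReal (5 * (|f x| - 1) ^ 2
          + (4 * (n + 2)) ^ β / β * gradTerm β (f x) (deriv f x)) ∂(muAlpha α) := by
  have hα : 1 ≤ α := hαβ.lt.le
  have h := lintegral_muAlpha hα fun x => ENNReal.ofReal (f x ^ 2)
  rw [hf1, mul_one] at h
  refine lintegral_muAlpha_le hα ?_ ?_
  · exact lintegral_entropyFun_halfMeasure_le hαβ hα2 hn hf (h ▸ le_self_add)
  · have h2 := lintegral_entropyFun_halfMeasure_le hαβ hα2 hn (contDiff_comp_neg hf)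
      (h ▸ le_add_self)
    simpa only [deriv_comp_neg, gradTerm_neg] using h2

theorem lintegral_entropyFun_muAlpha_one_le {f : ℝ → ℝ} (hf : ContDiff ℝ 1 f)
    (hf' : ∀ x, |deriv f x| ≤ 1 + |f x| / 12) {M : ℝ≥0∞}
    (hM : ∫⁻ x, ENNReal.ofReal ((|f x| - 1) ^ 2) ∂(muAlpha 1) ≤ M) :
    ∫⁻ x, ENNReal.ofReal (entropyFun (f x ^ 2)) ∂(muAlpha 1)
      ≤ (289 + 88 * (17 + 88 * (ENNReal.ofReal (partitionZ 1) * M))) *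
        ∫⁻ x, ENNReal.ofReal ((|f x| - 1) ^ 2) ∂(muAlpha 1) := by
  have h := lintegral_muAlpha le_rfl fun x => ENNReal.ofReal ((|f x| - 1) ^ 2)
  have hM' : ENNReal.ofReal (partitionZ 1) * ∫⁻ x, ENNReal.ofReal ((|f x| - 1) ^ 2) ∂(muAlpha 1)
      ≤ ENNReal.ofReal (partitionZ 1) * M := by gcongr
  rw [h] at hM'
  refine lintegral_muAlpha_le le_rfl ?_ ?_
  · exact lintegral_entropyFun_halfMeasure_one_le hf hf' (le_self_add.trans hM')
  · exact lintegral_entropyFun_halfMeasure_one_le (contDiff_comp_neg hf)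
      (fun x => by simpa [deriv_comp_neg] using hf' (-x)) (le_add_self.trans hM')

/-! ### Entropy and variance -/

lemma entropy_eq_ofReal {μ : Measure ℝ} {g : ℝ → ℝ} {m : ℝ} (hm : ∫ x, g x ∂μ = m)
    (hi : Integrable (fun x => g x * Real.log (g x / m)) μ) :
    entropy μ g = ENNReal.ofReal (∫ x, g x * Real.log (g x / m) ∂μ) := by
  subst hm
  exact if_pos hi

lemma entropy_eq_top {μ : Measure ℝ} {g : ℝ → ℝ} {m : ℝ} (hm : ∫ x, g x ∂μ = m)
    (hi : ¬ Integrable (fun x => g x * Real.log (g x / m)) μ) : entropy μ g = ⊤ := by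
  subst hm
  exact if_neg hi

/-- For a function of unit norm the entropy is at most the integral of `entropyFun (f²)`; in
particular it is finite as soon as that integral is. -/
lemma entropy_sq_le_lintegral {μ : Measure ℝ} [IsProbabilityMeasure μ] {f : ℝ → ℝ}
    (hf : Measurable f) (h1 : ∫ x, f x ^ 2 ∂μ = 1) :
    entropy μ (fun x => f x ^ 2) ≤ ∫⁻ x, ENNReal.ofReal (entropyFun (f x ^ 2)) ∂μ := by
  by_cases hfin : ∫⁻ x, ENNReal.ofReal (entropyFun (f x ^ 2)) ∂μ = ⊤
  · simp [hfin]
  have hi : Integrable (fun x => f x ^ 2) μ := .of_integral_ne_zero (by simp [h1])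
  have hm : Measurable fun x => entropyFun (f x ^ 2) := by
    unfold entropyFun
    fun_prop
  have h0 : 0 ≤ᵐ[μ] fun x => entropyFun (f x ^ 2) :=
    .of_forall fun x => entropyFun_nonneg (sq_nonneg _)
  have hθ : Integrable (fun x => entropyFun (f x ^ 2)) μ :=
    (lintegral_ofReal_ne_top_iff_integrable hm.aestronglyMeasurable h0).1 hfin
  have e : (fun x => f x ^ 2 * Real.log (f x ^ 2 / 1))
      = fun x => entropyFun (f x ^ 2) + (f x ^ 2 - 1) := by
    funext x; unfold entropyFun; rw [div_one]; ring
  have hi2 : Integrable (fun x => f x ^ 2 - 1) μ := hi.sub (integrable_const 1)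
  rw [entropy_eq_ofReal h1 (e ▸ hθ.add hi2), e, integral_add hθ hi2,
    integral_sub hi (integrable_const 1), h1, ← ofReal_integral_eq_lintegral_ofReal hθ h0]
  simp

lemma lintegral_sq_eq_one {μ : Measure ℝ} {f : ℝ → ℝ} (h1 : ∫ x, f x ^ 2 ∂μ = 1) :
    ∫⁻ x, ENNReal.ofReal (f x ^ 2) ∂μ = 1 := by
  have hi : Integrable (fun x => f x ^ 2) μ := .of_integral_ne_zero (by simp [h1])
  rw [← ofReal_integral_eq_lintegral_ofReal hi (.of_forall fun x => sq_nonneg _), h1,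
    ENNReal.ofReal_one]

lemma integrable_of_integral_sq_eq_one {μ : Measure ℝ} [IsProbabilityMeasure μ] {f : ℝ → ℝ}
    (hf : Measurable f) (h1 : ∫ x, f x ^ 2 ∂μ = 1) : Integrable f μ :=
  ((memLp_two_iff_integrable_sq hf.aestronglyMeasurable).2
    (.of_integral_ne_zero (by simp [h1]))).integrable one_le_two

/-- The squared `L²` distance from `|f|` to `1` is `2 - 2 ∫ |f| ≤ 2 (1 - (∫ |f|)²)`. -/
lemma lintegral_abs_sub_one_sq_le {μ : Measure ℝ} [IsProbabilityMeasure μ] {f : ℝ → ℝ}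
    (hf : Measurable f) (h1 : ∫ x, f x ^ 2 ∂μ = 1) :
    ∫⁻ x, ENNReal.ofReal ((|f x| - 1) ^ 2) ∂μ
      ≤ ENNReal.ofReal (2 * (∫ x, f x ^ 2 ∂μ - (∫ x, f x ∂μ) ^ 2)) := by
  have hi : Integrable (fun x => f x ^ 2) μ := .of_integral_ne_zero (by simp [h1])
  have hfi := integrable_of_integral_sq_eq_one hf h1
  have hai : Integrable (fun x => 2 * |f x|) μ := hfi.abs.const_mul 2
  have e : (fun x => (|f x| - 1) ^ 2) = fun x => f x ^ 2 - 2 * |f x| + 1 := by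
    funext x; rw [← sq_abs (f x)]; ring
  have hi2 : Integrable (fun x => f x ^ 2 - 2 * |f x|) μ := hi.sub hai
  have hi3 : Integrable (fun x => f x ^ 2 - 2 * |f x| + 1) μ := hi2.add (integrable_const 1)
  have hval : ∫ x, (|f x| - 1) ^ 2 ∂μ = 2 - 2 * ∫ x, |f x| ∂μ := by
    rw [e, integral_add hi2 (integrable_const 1), integral_sub hi hai, integral_const_mul, h1]
    simp
    ring
  rw [← ofReal_integral_eq_lintegral_ofReal (e ▸ hi3) (.of_forall fun x => sq_nonneg _), hval, h1]
  refine ENNReal.ofReal_le_ofReal ?_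
  have hle1 : 0 ≤ ∫ x, (|f x| - 1) ^ 2 ∂μ := integral_nonneg fun x => sq_nonneg _
  have hm0 : 0 ≤ ∫ x, |f x| ∂μ := integral_nonneg fun x => abs_nonneg _
  have hsq : (∫ x, f x ∂μ) ^ 2 ≤ (∫ x, |f x| ∂μ) ^ 2 :=
    sq_le_sq' (by
      linarith [neg_abs_le (∫ x, f x ∂μ), abs_integral_le_integral_abs (f := f) (μ := μ)])
      ((le_abs_self _).trans abs_integral_le_integral_abs)
  rw [hval] at hle1
  nlinarith

/-- The variance is at most the mean square distance to any constant. -/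
lemma ofReal_variance_le {μ : Measure ℝ} [IsProbabilityMeasure μ] {f : ℝ → ℝ}
    (hf : Measurable f) (h1 : ∫ x, f x ^ 2 ∂μ = 1) (c : ℝ) :
    ENNReal.ofReal (∫ x, f x ^ 2 ∂μ - (∫ x, f x ∂μ) ^ 2)
      ≤ ∫⁻ x, ENNReal.ofReal ((f x - c) ^ 2) ∂μ := by
  have hi : Integrable (fun x => f x ^ 2) μ := .of_integral_ne_zero (by simp [h1])
  have hfi := (integrable_of_integral_sq_eq_one hf h1).const_mul (2 * c)
  have e : (fun x => (f x - c) ^ 2) = fun x => f x ^ 2 - 2 * c * f x + c ^ 2 := by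
    funext x; ring
  have hi2 : Integrable (fun x => f x ^ 2 - 2 * c * f x) μ := hi.sub hfi
  have hi3 : Integrable (fun x => f x ^ 2 - 2 * c * f x + c ^ 2) μ :=
    hi2.add (integrable_const _)
  rw [← ofReal_integral_eq_lintegral_ofReal (e ▸ hi3) (.of_forall fun x => sq_nonneg _), e,
    integral_add hi2 (integrable_const _), integral_sub hi hfi, integral_const_mul]
  refine ENNReal.ofReal_le_ofReal ?_
  simp
  nlinarith [sq_nonneg ((∫ x, f x ∂μ) - c)]

/-- The entropy inequality for `1 < α ≤ 2`, for functions of arbitrary sign. -/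
theorem entropy_le_variance_add {α β : ℝ} (hαβ : α.HolderConjugate β) (hα2 : α ≤ 2) :
    ∃ A B : ℝ, 0 < A ∧ 0 < B ∧ ∀ f : ℝ → ℝ, ContDiff ℝ 1 f →
      ∫ x, f x ^ 2 ∂(muAlpha α) = 1 →
      entropy (muAlpha α) (fun x => f x ^ 2) ≤
        ENNReal.ofReal (A * (∫ x, f x ^ 2 ∂(muAlpha α) - (∫ x, f x ∂(muAlpha α)) ^ 2)) +
        ENNReal.ofReal B *
          ∫⁻ x, ENNReal.ofReal (gradTerm β (f x) (deriv f x)) ∂(muAlpha α) := by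
  have hα := hαβ.lt
  have hβ0 : 0 < β := hαβ.symm.pos
  have hZ := partitionZ_pos hα.le
  have := isProbabilityMeasure_muAlpha hα.le
  obtain ⟨n, hn⟩ := exists_nat_ge (1 / (α - 1))
  have hn' : (n + 2 : ℝ) ≤ (n + 1) * α := by
    have h1 := (div_le_iff₀ (by linarith : 0 < α - 1)).1 hn
    nlinarith
  set K : ℝ := 2 + 2 ^ (n + 2) * (8 * partitionZ α + 2) with hK
  have hK0 : 0 < K := by positivity
  set c : ℝ := (4 * (n + 2)) ^ β / β
  have hc0 : 0 < c := div_pos (Real.rpow_pos_of_pos (by positivity) _) hβ0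
  refine ⟨K * 10, K * c, by positivity, by positivity, fun f hf h1 => ?_⟩
  have hfm := hf.continuous.measurable
  have hKe : (2 + 2 ^ (n + 2) * (8 * ENNReal.ofReal (partitionZ α) + 2) : ℝ≥0∞)
      = ENNReal.ofReal K := by
    rw [hK, ENNReal.ofReal_add (by norm_num) (by positivity), ENNReal.ofReal_mul (by positivity),
      ENNReal.ofReal_add (by positivity) (by norm_num), ENNReal.ofReal_mul (by norm_num),
      ENNReal.ofReal_pow (by norm_num)]
    simp
  have h2 := lintegral_entropyFun_muAlpha_le hαβ hα2 hn' hf (lintegral_sq_eq_one h1)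
  rw [hKe, lintegral_ofReal_add _ (by fun_prop) (fun x => by positivity)
    (fun x => mul_nonneg hc0.le (gradTerm_nonneg _ _ _)),
    lintegral_ofReal_const_mul _ (by norm_num), lintegral_ofReal_const_mul _ hc0.le, mul_add] at h2
  refine ((entropy_sq_le_lintegral hfm h1).trans h2).trans (add_le_add ?_ ?_)
  · refine (mul_le_mul_right (mul_le_mul_right (lintegral_abs_sub_one_sq_le hfm h1) _) _).trans ?_
    rw [← ENNReal.ofReal_mul (by norm_num), ← ENNReal.ofReal_mul hK0.le]
    exact ENNReal.ofReal_le_ofReal (le_of_eq (by ring))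
  · rw [← mul_assoc, ← ENNReal.ofReal_mul hK0.le]

/-- For the exponential measure the entropy is dominated by the variance alone when the derivative
grows at most like a small multiple of the function. -/
theorem entropy_le_variance_one :
    ∃ A : ℝ, 0 < A ∧ ∀ f : ℝ → ℝ, ContDiff ℝ 1 f →
      ∫ x, f x ^ 2 ∂(muAlpha 1) = 1 → (∀ x, |deriv f x| ≤ 1 + |f x| / 12) →
      entropy (muAlpha 1) (fun x => f x ^ 2) ≤
        ENNReal.ofReal (A * (∫ x, f x ^ 2 ∂(muAlpha 1) - (∫ x, f x ∂(muAlpha 1)) ^ 2)) := by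
  have hZ := partitionZ_pos le_rfl
  have := isProbabilityMeasure_muAlpha le_rfl
  set K : ℝ := 289 + 88 * (17 + 88 * (partitionZ 1 * 2)) with hK
  have hK0 : 0 < K := by positivity
  refine ⟨K * 2, by positivity, fun f hf h1 hf' => ?_⟩
  have hfm := hf.continuous.measurable
  have hKe : (289 + 88 * (17 + 88 * (ENNReal.ofReal (partitionZ 1) * 2)) : ℝ≥0∞)
      = ENNReal.ofReal K := by
    rw [hK, ENNReal.ofReal_add (by norm_num) (by positivity), ENNReal.ofReal_mul (by positivity),
      ENNReal.ofReal_add (by positivity) (by positivity), ENNReal.ofReal_mul (by norm_num),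
      ENNReal.ofReal_mul (by positivity)]
    simp
  have hv := lintegral_abs_sub_one_sq_le hfm h1
  have hM : ∫⁻ x, ENNReal.ofReal ((|f x| - 1) ^ 2) ∂(muAlpha 1) ≤ 2 := by
    refine hv.trans ?_
    rw [h1]
    calc _ ≤ ENNReal.ofReal 2 := ENNReal.ofReal_le_ofReal
            (by nlinarith [sq_nonneg (∫ x, f x ∂(muAlpha 1))])
      _ = 2 := by simp
  have h2 := lintegral_entropyFun_muAlpha_one_le hf hf' hM
  rw [hKe] at h2
  refine ((entropy_sq_le_lintegral hfm h1).trans h2).trans ?_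
  refine (mul_le_mul_right hv _).trans ?_
  rw [← ENNReal.ofReal_mul hK0.le, mul_assoc]

theorem variance_le_lintegral_deriv_sq {α : ℝ} (hα : 1 ≤ α) {f : ℝ → ℝ} (hf : ContDiff ℝ 1 f)
    (h1 : ∫ x, f x ^ 2 ∂(muAlpha α) = 1) :
    ENNReal.ofReal (∫ x, f x ^ 2 ∂(muAlpha α) - (∫ x, f x ∂(muAlpha α)) ^ 2)
      ≤ 144 * ∫⁻ x, ENNReal.ofReal (deriv f x ^ 2) ∂(muAlpha α) := by
  have := isProbabilityMeasure_muAlpha hα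
  refine ((ofReal_variance_le hf.continuous.measurable h1 (f 0)).trans
    (poincare_muAlpha hα hf)).trans ?_
  rw [lintegral_ofReal_const_mul _ (by norm_num), ENNReal.ofReal_ofNat]

/-! ### The modified logarithmic Sobolev inequality -/

/-- The zeros of `f` at which the derivative does not vanish are isolated, hence countable. -/
lemma countable_zeros_deriv_ne_zero (f : ℝ → ℝ) :
    {x | f x = 0 ∧ deriv f x ≠ 0}.Countable := by
  set s := {x | f x = 0 ∧ deriv f x ≠ 0}
  refine (countable_setOfPred_isolated_right_within (s := s)).mono fun x hx =>
    (show x ∈ s ∧ _ from ⟨hx, ?_⟩)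
  have hd : HasDerivAt f (deriv f x) x :=
    (differentiableAt_of_deriv_ne_zero hx.2).hasDerivAt
  have h1 : ∀ᶠ z in 𝓝[≠] x, f z ≠ 0 := hd.eventually_ne hx.2
  rw [← empty_mem_iff_bot]
  have h2 : ∀ᶠ z in 𝓝[s ∩ Ioi x] x, f z ≠ 0 :=
    h1.filter_mono (nhdsWithin_mono _ fun z hz => (mem_Ioi.1 hz.2).ne')
  filter_upwards [h2, self_mem_nhdsWithin] with z hz hz2
  exact hz hz2.1.1

lemma muAlpha_absolutelyContinuous (α : ℝ) : muAlpha α ≪ volume :=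
  withDensity_absolutelyContinuous _ _

lemma lintegral_deriv_sq_le {a α γ : ℝ} {f : ℝ → ℝ}
    (h : ∀ x, f x ≠ 0 → ENNReal.ofReal ((deriv f x / f x) ^ 2)
      ≤ ENNReal.ofReal γ * modH a α (deriv f x / f x)) :
    ∫⁻ x, ENNReal.ofReal (deriv f x ^ 2) ∂(muAlpha α) ≤ ENNReal.ofReal γ *
      ∫⁻ x, modH a α (deriv f x / f x) * ENNReal.ofReal (f x ^ 2) ∂(muAlpha α) := by
  rw [← lintegral_const_mul' _ _ ENNReal.ofReal_ne_top]
  refine lintegral_mono_ae ?_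
  have h0 : ∀ᵐ x ∂(muAlpha α), ¬ (f x = 0 ∧ deriv f x ≠ 0) :=
    (muAlpha_absolutelyContinuous α).ae_le
      ((countable_zeros_deriv_ne_zero f).ae_notMem volume)
  filter_upwards [h0] with x hx
  by_cases hfx : f x = 0
  · have : deriv f x = 0 := by by_contra h; exact hx ⟨hfx, h⟩
    simp [this]
  · rw [← mul_assoc]
    refine le_trans (le_of_eq ?_) (mul_le_mul_left (h x hfx) _)
    rw [← ENNReal.ofReal_mul (sq_nonneg _), ← mul_pow, div_mul_cancel₀ _ hfx]

/-- Both sides of `LSI` are homogeneous in `f`, so that it suffices to consider `f` with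
`∫ f² dμ = 1`. -/
lemma satisfiesLSI_of_normalized {μ : Measure ℝ} {a α C : ℝ}
    (h : ∀ f : ℝ → ℝ, ContDiff ℝ ∞ f → ∫ x, f x ^ 2 ∂μ = 1 →
      entropy μ (fun x => f x ^ 2) ≤
        ENNReal.ofReal C * ∫⁻ x, modH a α (deriv f x / f x) * ENNReal.ofReal (f x ^ 2) ∂μ) :
    SatisfiesLSI μ a α C := by
  intro f hf hf2
  set m := ∫ x, f x ^ 2 ∂μ with hm
  have hm0 : 0 ≤ m := integral_nonneg fun x => sq_nonneg _
  rcases hm0.eq_or_lt with hm0 | hm0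
  · have : entropy μ (fun x => f x ^ 2) = 0 := by
      rw [entropy_eq_ofReal hm0.symm] <;> simp
    rw [this]
    exact zero_le
  set k := (Real.sqrt m)⁻¹ with hk
  have hk0 : k ≠ 0 := inv_ne_zero (Real.sqrt_pos.2 hm0).ne'
  have hk2 : k ^ 2 = m⁻¹ := by rw [hk, inv_pow, Real.sq_sqrt hm0.le]
  have hg2 : ∀ x, (k * f x) ^ 2 = m⁻¹ * f x ^ 2 := fun x => by rw [mul_pow, hk2]
  have hgf : ∀ x, f x ^ 2 = m * (k * f x) ^ 2 := fun x => by
    rw [hg2, mul_inv_cancel_left₀ hm0.ne']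
  have hint : ∫ x, (k * f x) ^ 2 ∂μ = 1 := by
    simp only [hg2]
    rw [integral_const_mul, ← hm, inv_mul_cancel₀ hm0.ne']
  have hg := h (fun x => k * f x) (contDiff_const.mul hf) hint
  have hd : ∀ x, deriv (fun x => k * f x) x / (k * f x) = deriv f x / f x := fun x => by
    rw [deriv_const_mul_field, mul_div_mul_left _ _ hk0]
  have hent : entropy μ (fun x => f x ^ 2)
      = ENNReal.ofReal m * entropy μ (fun x => (k * f x) ^ 2) := by
    have e : (fun x => f x ^ 2 * Real.log (f x ^ 2 / m))
        = fun x => m * ((k * f x) ^ 2 * Real.log ((k * f x) ^ 2 / 1)) := by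
      funext x
      rw [div_one, ← mul_assoc, ← hgf, hg2, div_eq_inv_mul]
    by_cases hi : Integrable (fun x => (k * f x) ^ 2 * Real.log ((k * f x) ^ 2 / 1)) μ
    · rw [entropy_eq_ofReal hint hi, entropy_eq_ofReal hm.symm (e ▸ hi.const_mul m), e,
        integral_const_mul, ENNReal.ofReal_mul hm0.le]
    · rw [entropy_eq_top hint hi, ENNReal.mul_top (by simpa using hm0)]
      refine entropy_eq_top hm.symm fun hi' => hi ?_
      rw [e] at hi'
      exact (integrable_const_mul_iff (isUnit_iff_ne_zero.2 hm0.ne') _).1 hi'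
  have hrhs : ∫⁻ x, modH a α (deriv f x / f x) * ENNReal.ofReal (f x ^ 2) ∂μ
      = ENNReal.ofReal m * ∫⁻ x, modH a α (deriv f x / f x) *
        ENNReal.ofReal ((k * f x) ^ 2) ∂μ := by
    rw [← lintegral_const_mul' _ _ ENNReal.ofReal_ne_top]
    refine lintegral_congr fun x => ?_
    rw [hgf x, ENNReal.ofReal_mul hm0.le, mul_left_comm]
  simp only [hd] at hg
  rw [hent, hrhs, mul_left_comm]
  gcongr

lemma ofReal_rpow_le_modH {α : ℝ} (hα : 1 < α) (hα2 : α ≤ 2) (r : ℝ) :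
    ENNReal.ofReal (|r| ^ α.conjExponent) ≤ ENNReal.ofReal α.conjExponent * modH 1 α r ∧
      ENNReal.ofReal (r ^ 2) ≤ ENNReal.ofReal α.conjExponent * modH 1 α r := by
  have hαβ := Real.HolderConjugate.conjExponent hα
  have hβ2 : 2 ≤ α.conjExponent := by
    unfold Real.conjExponent
    rw [le_div_iff₀ (by linarith)]
    linarith
  set β := α.conjExponent
  have hr0 := abs_nonneg r
  have hrsq : |r| ^ (2 : ℝ) = r ^ 2 := by rw [Real.rpow_two, sq_abs]
  unfold modH
  rw [if_neg hα.ne']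
  split_ifs with h1
  · rw [← ENNReal.ofReal_mul (by linarith)]
    have h2 : r ^ 2 ≤ β * (r ^ 2 / 2) := by nlinarith [sq_nonneg r]
    have h3 : |r| ^ β ≤ r ^ 2 := by
      rw [← hrsq]
      exact Real.rpow_le_rpow_of_exponent_ge' hr0 h1 (by norm_num) hβ2
    exact ⟨ENNReal.ofReal_le_ofReal (h3.trans h2), ENNReal.ofReal_le_ofReal h2⟩
  · rw [← ENNReal.ofReal_mul (by linarith)]
    push Not at h1
    have h2 : |r| ^ β ≤ β * ((1 : ℝ) ^ (2 - β) * (|r| ^ β / β)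
        + 1 ^ 2 * ((β - 2) / (2 * β))) := by
      have h4 : 0 ≤ (β - 2) / (2 * β) := div_nonneg (by linarith) (by linarith)
      have h5 : β * (|r| ^ β / β) = |r| ^ β := mul_div_cancel₀ _ (by linarith)
      rw [Real.one_rpow, one_mul, one_pow, one_mul, mul_add, h5]
      nlinarith
    have h3 : r ^ 2 ≤ |r| ^ β := by
      rw [← hrsq]
      exact Real.rpow_le_rpow_of_exponent_le h1.le hβ2
    exact ⟨ENNReal.ofReal_le_ofReal h2, ENNReal.ofReal_le_ofReal (h3.trans h2)⟩

theorem exists_satisfiesLSI_of_one_lt {α : ℝ} (hα : 1 < α) (hα2 : α ≤ 2) :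
    ∃ C : ℝ, 0 < C ∧ SatisfiesLSI (muAlpha α) 1 α C := by
  have hαβ := Real.HolderConjugate.conjExponent hα
  obtain ⟨A, B, hA, hB, hAB⟩ := entropy_le_variance_add hαβ hα2
  have hβ0 : 0 < α.conjExponent := hαβ.symm.pos
  set β := α.conjExponent
  refine ⟨A * 144 * β + B * β, by positivity, satisfiesLSI_of_normalized fun f hf h1 => ?_⟩
  have hf1 : ContDiff ℝ 1 f := hf.of_le (by exact_mod_cast le_top)
  set I := ∫⁻ x, modH 1 α (deriv f x / f x) * ENNReal.ofReal (f x ^ 2) ∂(muAlpha α)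
  refine (hAB f hf1 h1).trans ?_
  rw [ENNReal.ofReal_add (by positivity) (by positivity), add_mul]
  refine add_le_add ?_ ?_
  · have h2 := (variance_le_lintegral_deriv_sq hα.le hf1 h1).trans
      (mul_le_mul_right (lintegral_deriv_sq_le
        fun x _ => (ofReal_rpow_le_modH hα hα2 _).2) _)
    rw [ENNReal.ofReal_mul hA.le, ENNReal.ofReal_mul (by positivity), ENNReal.ofReal_mul hA.le,
      mul_assoc, mul_assoc, ENNReal.ofReal_ofNat]
    exact mul_le_mul_right h2 _
  · rw [ENNReal.ofReal_mul hB.le, mul_assoc]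
    refine mul_le_mul_right ?_ _
    rw [← lintegral_const_mul' _ _ ENNReal.ofReal_ne_top]
    refine lintegral_mono fun x => ?_
    unfold gradTerm
    split_ifs
    · rw [ENNReal.ofReal_mul (Real.rpow_nonneg (abs_nonneg _) _), ← mul_assoc]
      exact mul_le_mul_left (ofReal_rpow_le_modH hα hα2 _).1 _
    · simp

/-- A nonempty open set has positive `muAlpha` measure. -/
lemma muAlpha_pos_of_isOpen {α : ℝ} (hα : 1 ≤ α) {U : Set ℝ} (hU : IsOpen U)
    (hne : U.Nonempty) : muAlpha α U ≠ 0 := by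
  have hac : volume ≪ muAlpha α := by
    refine withDensity_absolutelyContinuous'
      ((continuous_exp_neg_abs_rpow hα).div_const _).measurable.ennreal_ofReal.aemeasurable
      (.of_forall fun x => ?_)
    simpa using div_pos (Real.exp_pos _) (partitionZ_pos hα)
  exact fun h => (hU.measure_pos volume hne).ne' (hac h)

/-- If the right-hand side of the inequality is finite for `α = 1`, then `|f'| ≤ a |f|`: the
integrand is infinite on the open set where `|f'| > a |f|` and `f ≠ 0`, and `f` cannot vanish
identically near a point where `|f'| > 0`. -/
lemma abs_deriv_le_of_lintegral_ne_top {a : ℝ} (ha : 0 ≤ a) {f : ℝ → ℝ} (hf : ContDiff ℝ 1 f)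
    (hfin : ∫⁻ x, modH a 1 (deriv f x / f x) * ENNReal.ofReal (f x ^ 2) ∂(muAlpha 1) ≠ ⊤)
    (x : ℝ) : |deriv f x| ≤ a * |f x| := by
  have hc := hf.continuous
  have hc' := hf.continuous_deriv le_rfl
  set O := {x | a * |f x| < |deriv f x|}
  have hO : IsOpen O := isOpen_lt (by fun_prop) (by fun_prop)
  set U := O ∩ {x | f x ≠ 0}
  have hU : IsOpen U := hO.inter (isOpen_ne_fun hc continuous_const)
  have htop : ∀ x ∈ U, modH a 1 (deriv f x / f x) * ENNReal.ofReal (f x ^ 2) = ⊤ := by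
    rintro x ⟨hx1, hx2⟩
    have hfx : 0 < |f x| := abs_pos.2 hx2
    have : ¬ |deriv f x / f x| ≤ a := by
      rw [abs_div, div_le_iff₀ hfx, not_le]; exact hx1
    rw [modH, if_neg this, if_pos rfl, ENNReal.top_mul]
    simpa using hx2
  have hUe : U = ∅ := by
    by_contra hne
    refine hfin (top_le_iff.1 ?_)
    calc ⊤ = ⊤ * muAlpha 1 U := (ENNReal.top_mul
            (muAlpha_pos_of_isOpen le_rfl hU (nonempty_iff_ne_empty.2 hne))).symm
      _ = ∫⁻ _ in U, ⊤ ∂(muAlpha 1) := (setLIntegral_const _ _).symm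
      _ = ∫⁻ x in U, modH a 1 (deriv f x / f x) * ENNReal.ofReal (f x ^ 2) ∂(muAlpha 1) :=
          setLIntegral_congr_fun hU.measurableSet fun x hx => (htop x hx).symm
      _ ≤ _ := setLIntegral_le_lintegral _ _
  by_contra hx
  rw [not_le] at hx
  have h0 : f =ᶠ[𝓝 x] fun _ => 0 := by
    filter_upwards [hO.mem_nhds hx] with z hz
    by_contra hz0
    exact (hUe ▸ (⟨hz, hz0⟩ : z ∈ U) : z ∈ (∅ : Set ℝ))
  rw [h0.deriv_eq, deriv_const, abs_zero] at hx
  exact absurd hx (not_lt.2 (by positivity))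

theorem exists_satisfiesLSI_one :
    ∃ C : ℝ, 0 < C ∧ SatisfiesLSI (muAlpha 1) (1 / 12) 1 C := by
  obtain ⟨A, hA, hent⟩ := entropy_le_variance_one
  refine ⟨A * 144 * 2, by positivity, satisfiesLSI_of_normalized fun f hf h1 => ?_⟩
  have hf1 : ContDiff ℝ 1 f := hf.of_le (by exact_mod_cast le_top)
  set I := ∫⁻ x, modH (1 / 12) 1 (deriv f x / f x) * ENNReal.ofReal (f x ^ 2) ∂(muAlpha 1)
    with hI
  by_cases hfin : I = ⊤
  · rw [hfin, ENNReal.mul_top (by simp [hA])]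
    exact le_top
  have hf' := abs_deriv_le_of_lintegral_ne_top (by norm_num) hf1 hfin
  refine (hent f hf1 h1 fun x => by linarith [hf' x, abs_nonneg (f x)]).trans ?_
  have h2 := (variance_le_lintegral_deriv_sq le_rfl hf1 h1).trans
    (mul_le_mul_right (lintegral_deriv_sq_le (a := 1 / 12) (γ := 2) fun x hx => by
      have : |deriv f x / f x| ≤ 1 / 12 := by
        rw [abs_div, div_le_iff₀ (abs_pos.2 hx)]; exact hf' x
      rw [modH, if_pos this, ← ENNReal.ofReal_mul (by norm_num)]
      exact ENNReal.ofReal_le_ofReal (by linarith)) _)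
  rw [ENNReal.ofReal_mul hA.le, ENNReal.ofReal_mul (by positivity), ENNReal.ofReal_mul hA.le,
    mul_assoc, mul_assoc, ENNReal.ofReal_ofNat 144]
  exact mul_le_mul_right h2 _

end ModLSI

theorem mainTheorem1 :
    (∀ α β : ℝ, 1 < α → α ≤ 2 → 1 / α + 1 / β = 1 →
      ∃ A B : ℝ, 0 < A ∧ 0 < B ∧
        ∀ f : ℝ → ℝ, ContDiff ℝ ∞ f → (∀ x, 0 ≤ f x) →
          ∫ x, f x ^ 2 ∂(ModLSI.muAlpha α) = 1 →
          ModLSI.entropy (ModLSI.muAlpha α) (fun x => f x ^ 2) ≤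
            ENNReal.ofReal
                (A * (∫ x, f x ^ 2 ∂(ModLSI.muAlpha α) - (∫ x, f x ∂(ModLSI.muAlpha α)) ^ 2)) +
              ENNReal.ofReal B *
                ∫⁻ x in {x | 2 ≤ f x},
                  ENNReal.ofReal (|deriv f x / f x| ^ β * f x ^ 2) ∂(ModLSI.muAlpha α)) ∧
    (∃ A : ℝ, 0 < A ∧
      ∀ f : ℝ → ℝ, ContDiff ℝ 1 f → (∀ x, 0 ≤ f x) →
        ∫ x, f x ^ 2 ∂(ModLSI.muAlpha 1) = 1 →
        (∀ x, |deriv f x| ≤ 1) →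
        ModLSI.entropy (ModLSI.muAlpha 1) (fun x => f x ^ 2) ≤
          ENNReal.ofReal
            (A * (∫ x, f x ^ 2 ∂(ModLSI.muAlpha 1) - (∫ x, f x ∂(ModLSI.muAlpha 1)) ^ 2))) ∧
    (∀ α : ℝ, 1 ≤ α → α ≤ 2 →
      ∃ a C : ℝ, 0 < a ∧ 0 < C ∧ ModLSI.SatisfiesLSI (ModLSI.muAlpha α) a α C) := by
  refine ⟨fun α β hα hα2 hαβ => ?_, ?_, fun α hα hα2 => ?_⟩
  · have hconj : α.HolderConjugate β := by
      rw [Real.holderConjugate_iff]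
      exact ⟨hα, by simpa only [one_div] using hαβ⟩
    obtain ⟨A, B, hA, hB, h⟩ := ModLSI.entropy_le_variance_add hconj hα2
    refine ⟨A, B, hA, hB, fun f hf hf0 h1 => ?_⟩
    have hm : MeasurableSet {x | 2 ≤ f x} := measurableSet_le measurable_const
      hf.continuous.measurable
    refine (h f (hf.of_le (by exact_mod_cast le_top)) h1).trans (le_of_eq ?_)
    rw [← lintegral_indicator hm]
    congr 2
    refine lintegral_congr fun x => ?_
    by_cases hx : 2 ≤ f x <;> simp [ModLSI.gradTerm, Set.indicator, abs_of_nonneg (hf0 x), hx]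
  · obtain ⟨A, hA, h⟩ := ModLSI.entropy_le_variance_one
    refine ⟨A, hA, fun f hf _ h1 hf' => h f hf h1 fun x => ?_⟩
    linarith [hf' x, abs_nonneg (f x)]
  · rcases hα.eq_or_lt with rfl | hα1
    · obtain ⟨C, hC, h⟩ := ModLSI.exists_satisfiesLSI_one
      exact ⟨1 / 12, C, by norm_num, hC, h⟩
    · obtain ⟨C, hC, h⟩ := ModLSI.exists_satisfiesLSI_of_one_lt hα1 hα2
      exact ⟨1, C, one_pos, hC, h⟩
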